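/- Let $R_\theta$ be the rotation of $\mathbb R^2$ of angle $2\pi\theta$ about $0$. Let $f$ be a $C^1$ diffeomorphism of the closed unit disk $\mathbb D$ that preserves $dx\wedge dy$, fixes $0$, has no other periodic point (an irrational pseudo-rotation), and coincides with $R_\alpha$ on the unit circle. Let $\beta>\alpha$ be irrational with $(\alpha,\beta)\cap\mathbb Z=\emptyset$, and extend $f$ to $\mathbb R^2$ by $f(z)=R_{\alpha+|z|-1}(z)$ if $1\le |z|\le 1+\beta-\alpha$ and $f(z)=R_\beta(z)$ if $|z|\ge 1+\beta-\alpha$. Let $K>1$ and let $f=f_m\circ\dots\circ f_1$ ($m\ge 1$), where each $f_i$ is an area preserving homeomorphism of $\mathbb R^2$ that fixes $0$, induces a rotation on every circle of centre $0$ and radius $r\ge 1$, and is a $K$ Lipschitz untwisted homeomorphism. The latter means that $f_i$ is $K$ bi-Lipschitz and that there are continuous functions $g_i,g_i':\mathbb R^2\to\mathbb R$ with $$f_i(x,y)=(X,Y)\iff x=g_i(X,y)\ \text{ and }\ Y=g'_i(X,y),$$ such that $X\mapsto g_i(X,y)$ and $y\mapsto g_i'(X,y)$ are increasing and $K$ bi-Lipschitz,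 and $y\mapsto g_i(X,y)$ and $X\mapsto g'_i(X,y)$ are $K$ Lipschitz. Then $f_i$ coincides on the unit circle with $R_{\rho_i}$ for a unique $\rho_i\in(-1/4,1/4)$, and we assume that $\sum_{i=1}^m\rho_i=\alpha$ (that is, the natural isotopy from the identity to $f$ given by the decomposition has rotation number $\alpha$ on the unit circle). Extend $f_i,g_i,g'_i$ to $m$-periodic families indexed by $i\in\mathbb Z$. Let $b\ge 2$ and $a$ be integers with $b\alpha<a<b\beta$. Let $E_b$ be the space of $mb$-periodic sequences $\mathbf z=(z_i)_{i\in\mathbb Z}$ of points $z_i=(x_i,y_i)\in\mathbb R^2$, with scalar product $\sum_{0<i\le mb}(x_ix_i'+y_iy_i')$; let $\varphi$ be the shift $(z_i)\mapsto(z_{i+m})$ and let $\zeta$ be the Lipschitz vector field on $E_b$ (the gradient vector field of the action) $$\zeta_i(\mathbf z)=\bigl(y_i-g'_{i-1}(x_i,y_{i-1}),\ x_i-g_i(x_{i+1},y_i)\bigr),$$ with flow $\mathbf z\mapsto\mathbf z^t$. Let $\Sigma_a$ be the curve of zeros $\mathbf z$ of $\zeta$ such that $|z_i|=1+a/b-\alpha$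 for all $i$. Let $\Delta_a\subset E_b$ be a closed topological disk bounded by $\Sigma_a$ such that: (i) $\mathbf 0\in\Delta_a$; (ii) $\Delta_a$ is invariant by $\varphi$; (iii) each projection $\mathbf z\mapsto(x_i,y_{i-1})$ and (iv) each projection $\mathbf z\mapsto(x_i,y_i)$, $i\in\mathbb Z$, is one to one on $\Delta_a$; (v) $\Delta_a$ is invariant by the flow of $\zeta$; (vi) for every $\mathbf z\in\Delta_a^*:=\Delta_a\setminus(\{\mathbf 0\}\cup\Sigma_a)$ one has $\lim_{t\to-\infty}\mathbf z^t=\mathbf 0$ and $\lim_{t\to+\infty}d(\mathbf z^t,\Sigma_a)=0$. Let $V'$ be the open set of all $\mathbf z\in E_b$ such that, for every $i$, $x_i=0$ implies $y_{i-1}y_i>0$ and $y_i=0$ implies $x_ix_{i+1}>0$. Let $L$ be the continuous extension to $V'$ of the function $$L(\mathbf z)=\frac14\sum_{0<i\le mb}\operatorname{sign}(x_i)\bigl(\operatorname{sign}(y_i)-\operatorname{sign}(y_{i-1})\bigr)$$ defined on the set of $\mathbf z\in E_b$ all of whose coordinates $x_i,y_i$ are nonzero. Then for every $\mathbf z\in\Delta_a^*$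 one has $\zeta(\mathbf z)\in V'$ and $L(\zeta(\mathbf z))=a$. -/

import Mathlib

open Filter Topology MeasureTheory
open scoped NNReal

namespace PseudoRotation

noncomputable section

/-! The Euclidean plane is `ℂ`, a point `(x, y)` being `x + i y`. -/

/-- The rotation `R_θ` of the plane of angle `2πθ` about the origin. -/
def rot (θ : ℝ) (z : ℂ) : ℂ := Complex.exp (2 * Real.pi * θ * Complex.I) * z

/-- The closed unit disk. -/
def disk : Set ℂ := Metric.closedBall 0 1

/-- `f` restricts to a `C¹` diffeomorphism of the closed unit disk that preserves the area form
`dx ∧ dy` (only the values of `f` on the disk matter). -/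
structure IsSymplecticDiffeo (f : ℂ → ℂ) : Prop where
  contDiffOn : ContDiffOn ℝ 1 f disk
  exists_inverse : ∃ k : ℂ → ℂ, ContDiffOn ℝ 1 k disk ∧ Set.MapsTo f disk disk ∧
    Set.MapsTo k disk disk ∧ Set.InvOn k f disk disk
  det_eq_one : ∀ z ∈ disk, (fderivWithin ℝ f disk z).det = 1

/-- `f` is an irrational pseudo-rotation: a symplectic `C¹` diffeomorphism of the disk that fixes
`0` and has no other periodic point. -/
structure IsIrrationalPseudoRotation (f : ℂ → ℂ) : Prop extends IsSymplecticDiffeo f where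
  map_zero : f 0 = 0
  eq_zero_of_periodic : ∀ n : ℕ, 0 < n → ∀ z ∈ disk, f^[n] z = z → z = 0

/-- The extension to the plane of a map `f` of the disk that equals `R_α` on the unit circle. -/
def extendMap (f : ℂ → ℂ) (α β : ℝ) (z : ℂ) : ℂ :=
  if ‖z‖ ≤ 1 then f z
  else if ‖z‖ ≤ 1 + β - α then rot (α + ‖z‖ - 1) z
  else rot β z

/-- The homeomorphism `f` of the plane is untwisted, with associated functions `g`, `g'`:
`f (x, y) = (X, Y)` if and only if `x = g (X, y)` and `Y = g' (X, y)`. The monotonicity fields say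
that `X ↦ g (X, y)` and `y ↦ g' (X, y)` preserve orientation; then so does `f`. -/
structure IsUntwisted (f : ℂ ≃ₜ ℂ) (g g' : ℝ → ℝ → ℝ) : Prop where
  continuous_left : Continuous (fun p : ℝ × ℝ => g p.1 p.2)
  continuous_right : Continuous (fun p : ℝ × ℝ => g' p.1 p.2)
  map_eq_iff : ∀ x y X Y : ℝ, f ⟨x, y⟩ = ⟨X, Y⟩ ↔ x = g X y ∧ Y = g' X y
  strictMono_left : ∀ y, StrictMono (fun X => g X y)
  strictMono_right : ∀ X, StrictMono (fun y => g' X y)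

/-- `f` is a `K` Lipschitz untwisted homeomorphism, with associated functions `g`, `g'`. -/
structure IsLipschitzUntwisted (K : ℝ≥0) (f : ℂ ≃ₜ ℂ) (g g' : ℝ → ℝ → ℝ) : Prop
    extends IsUntwisted f g g' where
  lipschitz : LipschitzWith K f
  antilipschitz : AntilipschitzWith K f
  left_lipschitz : ∀ y, LipschitzWith K (fun X => g X y)
  left_antilipschitz : ∀ y, AntilipschitzWith K (fun X => g X y)
  right_lipschitz : ∀ X, LipschitzWith K (fun y => g' X y)
  right_antilipschitz : ∀ X, AntilipschitzWith K (fun y => g' X y)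
  left_lipschitz_snd : ∀ X, LipschitzWith K (fun y => g X y)
  right_lipschitz_fst : ∀ y, LipschitzWith K (fun X => g' X y)

/-- The composition `f_n ∘ ⋯ ∘ f_1`. -/
def comp (f : ℤ → ℂ ≃ₜ ℂ) : ℕ → ℂ → ℂ
  | 0 => id
  | n + 1 => fun z => f (n + 1) (comp f n z)

/-- `F = f_m ∘ ⋯ ∘ f_1` is a decomposition of the plane map `F` into area preserving `K` Lipschitz
untwisted homeomorphisms that fix `0` and induce a rotation on each circle of centre `0` and radius
at least `1`, the families being extended `m`-periodically to `ℤ`.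

Since `f_i` is untwisted, the rotation it induces on the unit circle has a unique angle `2π ρ_i`
with `|ρ_i| < 1 / 4`; this is the angle by which the natural isotopy
`x = (1 - s) X + s g_i (X, y)`, `Y = (1 - s) y + s g'_i (X, y)` from the identity to `f_i` turns the
unit circle around `0`. The last field says that the resulting isotopy from the identity to `F`
has rotation number `α` on the unit circle (and not just `α` modulo `1`). -/
structure IsDecomposition (K : ℝ≥0) (α : ℝ) (F : ℂ → ℂ) (m : ℕ)
    (f : ℤ → ℂ ≃ₜ ℂ) (g g' : ℤ → ℝ → ℝ → ℝ) : Prop where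
  pos : 0 < m
  periodic : ∀ i, f (i + m) = f i
  periodic_left : ∀ i, g (i + m) = g i
  periodic_right : ∀ i, g' (i + m) = g' i
  untwisted : ∀ i, IsLipschitzUntwisted K (f i) (g i) (g' i)
  map_zero : ∀ i, f i 0 = 0
  rotation : ∀ i, ∀ r : ℝ, 1 ≤ r → ∃ θ : ℝ, ∀ z : ℂ, ‖z‖ = r → f i z = rot θ z
  measurePreserving : ∀ i, MeasurePreserving (f i) volume volume
  comp_eq : comp f m = F
  rotation_number : ∃ ρ : ℤ → ℝ,
    (∀ i, |ρ i| < 1 / 4 ∧ ∀ z : ℂ, ‖z‖ = 1 → f i z = rot (ρ i) z) ∧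
    ∑ j ∈ Finset.range m, ρ (j + 1) = α

/-- The space `E_b` of `mb`-periodic sequences of points of the plane. Its topology is that of
coordinatewise convergence. -/
def E (m b : ℕ) : Submodule ℝ (ℤ → ℂ) where
  carrier := {z | ∀ i : ℤ, z (i + (m * b : ℕ)) = z i}
  add_mem' := fun hz hw i => by simp only [Pi.add_apply, hz i, hw i]
  zero_mem' := fun _ => rfl
  smul_mem' := fun c z hz i => by simp only [Pi.smul_apply, hz i]

/-- The norm of the scalar product `∑_{0 < i ≤ mb} (x_i x'_i + y_i y'_i)` of `E_b`. -/
def normE (m b : ℕ) (z : ℤ → ℂ) : ℝ := √(∑ j ∈ Finset.range (m * b), ‖z (j + 1)‖ ^ 2)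

/-- The shift `(z_i) ↦ (z_{i + m})`. -/
def shift (m : ℕ) (z : ℤ → ℂ) : ℤ → ℂ := fun i => z (i + m)

/-- The vector field
`ζ_i (z) = (y_i - g'_{i-1} (x_i, y_{i-1}), x_i - g_i (x_{i+1}, y_i))`. -/
def zeta (g g' : ℤ → ℝ → ℝ → ℝ) (z : ℤ → ℂ) : ℤ → ℂ := fun i =>
  ⟨(z i).im - g' (i - 1) (z i).re (z (i - 1)).im, (z i).re - g i (z (i + 1)).re (z i).im⟩

/-- `γ` is a complete orbit `t ↦ z^t` of the flow of `ζ` on `E_b`. -/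
def IsOrbit (m b : ℕ) (g g' : ℤ → ℝ → ℝ → ℝ) (γ : ℝ → ℤ → ℂ) : Prop :=
  (∀ t, γ t ∈ E m b) ∧ ∀ t i, HasDerivAt (fun s => γ s i) (zeta g g' (γ t) i) t

/-- The curve `Σ_a` of singular points of `ζ` that correspond to the circle `S_{a/b}` of centre `0`
and radius `1 + a / b - α`. -/
def singularCurve (α : ℝ) (m b : ℕ) (g g' : ℤ → ℝ → ℝ → ℝ) (a : ℤ) : Set (ℤ → ℂ) :=
  {z | z ∈ E m b ∧ zeta g g' z = 0 ∧ ∀ i, ‖z i‖ = 1 + a / b - α}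

/-- `Δ^* = Δ \ ({0} ∪ Σ)`. -/
def punctured (Δ S : Set (ℤ → ℂ)) : Set (ℤ → ℂ) := Δ \ ({0} ∪ S)

/-- `Δ` is an invariant disk `Δ_a`: a topological disk in `E_b` bounded by the curve `S = Σ_a`,
with its six characteristic properties. -/
structure IsInvariantDisk (m b : ℕ) (g g' : ℤ → ℝ → ℝ → ℝ) (S Δ : Set (ℤ → ℂ)) : Prop where
  subset : Δ ⊆ E m b
  isDisk : ∃ φ : ℂ → ℤ → ℂ, ContinuousOn φ disk ∧ Set.InjOn φ disk ∧ φ '' disk = Δ ∧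
    φ '' Metric.sphere 0 1 = S
  zero_mem : 0 ∈ Δ
  shift_image : shift m '' Δ = Δ
  injOn_left : ∀ i : ℤ, Set.InjOn (fun z : ℤ → ℂ => ((z i).re, (z (i - 1)).im)) Δ
  injOn_right : ∀ i : ℤ, Set.InjOn (fun z : ℤ → ℂ => ((z i).re, (z i).im)) Δ
  flow_invariant : ∀ γ, IsOrbit m b g g' γ → γ 0 ∈ Δ → ∀ t, γ t ∈ Δ
  limits : ∀ γ, IsOrbit m b g g' γ → γ 0 ∈ punctured Δ S →
    Tendsto γ atBot (𝓝 0) ∧ ∀ ε > 0, ∀ᶠ t in atTop, ∃ w ∈ S, normE m b (γ t - w) < ε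

/-- The open set `V'`. -/
def V' (m b : ℕ) : Set (ℤ → ℂ) :=
  {z | z ∈ E m b ∧ ∀ i : ℤ, ((z i).re = 0 → 0 < (z (i - 1)).im * (z i).im) ∧
    ((z i).im = 0 → 0 < (z i).re * (z (i + 1)).re)}

/-- The discrete linking function
`L (z) = 1/4 ∑_{0 < i ≤ mb} sign (x_i) (sign (y_i) - sign (y_{i-1}))`.
With the convention `sign 0 = 0` this formula also gives the continuous extension of `L` to `V'`,
as `L_eventually_eq` shows. -/
def L (m b : ℕ) (z : ℤ → ℂ) : ℝ :=
  1 / 4 * ∑ j ∈ Finset.range (m * b), (SignType.sign (z (j + 1)).re : ℝ) *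
    ((SignType.sign (z (j + 1)).im : ℝ) - (SignType.sign (z j).im : ℝ))

/-- Summation by parts: the second formula for `L`. -/
theorem sum_by_parts (N : ℕ) (σ τ : ℤ → ℝ) (hσ : ∀ i, σ (i + N) = σ i)
    (hτ : ∀ i, τ (i + N) = τ i) :
    ∑ j ∈ Finset.range N, σ (j + 1) * (τ (j + 1) - τ j) =
      ∑ j ∈ Finset.range N, τ (j + 1) * (σ (j + 1) - σ (j + 1 + 1)) := by
  have h := Finset.sum_range_sub (fun j : ℕ => σ (j + 1) * τ j) N
  have h1 : σ (N + 1) * τ N = σ 1 * τ 0 := by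
    rw [add_comm (N : ℤ) 1, hσ 1, ← zero_add (N : ℤ), hτ 0]
  simp only [Nat.cast_zero, zero_add, h1, sub_self] at h
  rw [← sub_eq_zero, ← Finset.sum_sub_distrib, ← h]
  refine Finset.sum_congr rfl fun j _ => ?_
  push_cast
  ring

/-- `L` is locally constant on `V'`. -/
theorem L_eventually_eq (m b : ℕ) (z : ℤ → ℂ) (hz : z ∈ V' m b) :
    ∀ᶠ w in 𝓝[E m b] z, L m b w = L m b z := by
  obtain ⟨hzE, hz⟩ := hz
  have sgn : ∀ p : (ℤ → ℂ) → ℝ, Continuous p → ∀ᶠ w in 𝓝[E m b] z,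
      p z ≠ 0 → SignType.sign (p w) = SignType.sign (p z) := by
    intro p hp
    apply Filter.Eventually.filter_mono nhdsWithin_le_nhds
    rcases lt_trichotomy (p z) 0 with h | h | h
    · filter_upwards [hp.continuousAt.eventually (gt_mem_nhds h)] with w hw _
      rw [sign_neg hw, sign_neg h]
    · exact Filter.Eventually.of_forall fun w h' => absurd h h'
    · filter_upwards [hp.continuousAt.eventually (lt_mem_nhds h)] with w hw _
      rw [sign_pos hw, sign_pos h]
  have hre : ∀ᶠ w in 𝓝[E m b] z, ∀ j ∈ Finset.range (m * b), (z (j + 1)).re ≠ 0 →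
      SignType.sign (w (j + 1)).re = SignType.sign (z (j + 1)).re :=
    (Filter.eventually_all_finset _).2 fun j _ => sgn (fun w => (w (j + 1)).re) (by fun_prop)
  have him : ∀ᶠ w in 𝓝[E m b] z, ∀ j ∈ Finset.range (m * b), (z (j + 1)).im ≠ 0 →
      SignType.sign (w (j + 1)).im = SignType.sign (z (j + 1)).im :=
    (Filter.eventually_all_finset _).2 fun j _ => sgn (fun w => (w (j + 1)).im) (by fun_prop)
  have him' : ∀ᶠ w in 𝓝[E m b] z, ∀ j ∈ Finset.range (m * b), (z j).im ≠ 0 →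
      SignType.sign (w j).im = SignType.sign (z j).im :=
    (Filter.eventually_all_finset _).2 fun j _ => sgn (fun w => (w j).im) (by fun_prop)
  filter_upwards [hre, him, him', self_mem_nhdsWithin] with w h1 h2 h3 hwE
  unfold L
  congr 1
  have same : ∀ u v : ℝ, 0 < u * v → SignType.sign u = SignType.sign v := by
    intro u v h
    rcases pos_and_pos_or_neg_and_neg_of_mul_pos h with ⟨a, c⟩ | ⟨a, c⟩
    · rw [sign_pos a, sign_pos c]
    · rw [sign_neg a, sign_neg c]
  have per : ∀ v ∈ E m b, ∀ i : ℤ, v (i + (m * b : ℕ)) = v i := fun v hv => hv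
  calc ∑ j ∈ Finset.range (m * b), (SignType.sign (w (j + 1)).re : ℝ) *
        ((SignType.sign (w (j + 1)).im : ℝ) - (SignType.sign (w j).im : ℝ))
      = ∑ j ∈ Finset.range (m * b), (SignType.sign (z (j + 1)).re : ℝ) *
        ((SignType.sign (w (j + 1)).im : ℝ) - (SignType.sign (w j).im : ℝ)) := by
        refine Finset.sum_congr rfl fun j hj => ?_
        by_cases h : (z (j + 1)).re = 0
        · have h' := (hz (j + 1)).1 h
          rw [add_sub_cancel_right] at h'
          rw [h2 j hj (right_ne_zero_of_mul h'.ne'), h3 j hj (left_ne_zero_of_mul h'.ne'),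
            same _ _ h', sub_self, mul_zero, mul_zero]
        · rw [h1 j hj h]
    _ = ∑ j ∈ Finset.range (m * b), (SignType.sign (w (j + 1)).im : ℝ) *
        ((SignType.sign (z (j + 1)).re : ℝ) - (SignType.sign (z (j + 1 + 1)).re : ℝ)) :=
        sum_by_parts (m * b) (fun i => (SignType.sign (z i).re : ℝ))
          (fun i => (SignType.sign (w i).im : ℝ)) (fun i => by simp only [per z hzE i])
          (fun i => by simp only [per w hwE i])
    _ = ∑ j ∈ Finset.range (m * b), (SignType.sign (z (j + 1)).im : ℝ) *
        ((SignType.sign (z (j + 1)).re : ℝ) - (SignType.sign (z (j + 1 + 1)).re : ℝ)) := by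
        refine Finset.sum_congr rfl fun j hj => ?_
        by_cases h : (z (j + 1)).im = 0
        · rw [same _ _ ((hz (j + 1)).2 h), sub_self, mul_zero, mul_zero]
        · rw [h2 j hj h]
    _ = _ :=
        (sum_by_parts (m * b) (fun i => (SignType.sign (z i).re : ℝ))
          (fun i => (SignType.sign (z i).im : ℝ)) (fun i => by simp only [per z hzE i])
          (fun i => by simp only [per z hzE i])).symm

end

end PseudoRotation

/-!
Two distinct points `z`, `w` of the invariant disk `Δ` always have `z - w ∈ V'` and linking number
`L (z - w) = a`; letting `w` be the points of the orbit of `z` close to `z`, one gets the same for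
the velocity `ζ (z)`.

*Differences.* A projection `z ↦ z_i` is injective on `Δ` and maps the boundary `Σ_a` onto the
circle of radius `r = 1 + a / b - α`. As the circle has no continuous logarithm, the image of `Δ` is
the whole round disk (`image_disk_eq_closedBall`), so that every point of `Δ` is a continuous
function of `z_i` in the round disk. On a horizontal chord, `x_{i+1}` is a continuous function of
`x_i`, injective because `z ↦ (x_{i+1}, y_i)` is, and it increases from one end of the chord to the
other because the ends correspond to points of `Σ_a`, where `x_i = g_i (x_{i+1}, y_i)`. Hence it is
increasing on the chord (`IsInvariantDisk.re_lt`). The same argument on vertical chords shows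
that `y_{i-1}` increases with `y_i` (`IsInvariantDisk.im_lt`). This says that `z - w ∈ V'`. The
disk minus a point is connected and `L` is locally constant on `V'`, so `L (z - w)` does not depend
on `z` and `w` (`IsInvariantDisk.L_sub_eq_L`). Its value is found for `z ∈ Σ_a` and `w = 0`: the
points `z_i` turn around `0` by angles of less than a quarter turn, whose sum over a period is `a`
turns; this sum is known up to an integer, and the integer is found by continuity from the unit
circle (`IsDecomposition.sum_angle`, `IsDecomposition.L_singularCurve`).

*The velocity.* Let `z ∈ Δ^*`. The orbit of `z` exists for all times because `ζ` is Lipschitz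
(`exists_orbit_of_lipschitz`), it stays in `Δ`, and `ζ (z) ≠ 0` because `z^t → 0` as `t → -∞`. In the
interleaved coordinates `(-1)^i x_i`, `(-1)^i y_i`, the increments `z^t - z` and the velocities satisfy
the inequalities of a cyclic system in which each coordinate is driven positively by its two
neighbours (`IsPositivelyCoupled`). In such a system a nonzero coordinate of `ζ (z)` makes the
coordinates of `z^t - z` in an adjacent block of zeros of `ζ (z)` nonzero, to an order in `t` which
is given by the distance. For small `t > 0` it imposes its own sign up to the middle of the block;
for small `t < 0` the signs alternate at the ends of the block. So the number of sign changes is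
strictly larger for `t < 0` than for `t > 0`, unless the zeros of `ζ (z)` are isolated and lie between
coordinates of opposite signs, which means `ζ (z) ∈ V'` (`IsPositivelyCoupled.mul_neg`). The number of
sign changes is `mb - 2 L` and `L (z^t - z) = a` for all small `t ≠ 0`; therefore `ζ (z) ∈ V'`, and
`L (ζ (z)) = a` because `ζ (z)` is the limit of `(z^t - z) / t`.
-/

namespace PseudoRotation

/-! ### Embedded disks of the plane bounded by a round circle -/

theorem continuousOn_invFunOn_of_isCompact {X Y : Type*} [TopologicalSpace X] [TopologicalSpace Y]
    [T2Space Y] [Nonempty X] {S : Set X} (hS : IsCompact S) {ψ : X → Y} (hc : ContinuousOn ψ S)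
    (hi : Set.InjOn ψ S) : ContinuousOn (Function.invFunOn ψ S) (ψ '' S) := by
  rw [continuousOn_iff_isClosed]
  intro t ht
  refine ⟨ψ '' (S ∩ t), ((hS.inter_right ht).image_of_continuousOn
    (hc.mono Set.inter_subset_left)).isClosed, ?_⟩
  ext y
  constructor
  · rintro ⟨hy, x, hx, rfl⟩
    have : Function.invFunOn ψ S (ψ x) ∈ t := hy
    rw [hi.leftInvOn_invFunOn hx] at this
    exact ⟨⟨x, ⟨hx, this⟩, rfl⟩, x, hx, rfl⟩
  · rintro ⟨⟨x, ⟨hx, hxt⟩, rfl⟩, -⟩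
    refine ⟨?_, x, hx, rfl⟩
    change Function.invFunOn ψ S (ψ x) ∈ t
    rwa [hi.leftInvOn_invFunOn hx]

/-- A continuous function on the line all of whose values lie in `2πiℤ` is constant. -/
theorem eq_of_exp_eq_one {F : ℝ → ℂ} (hF : Continuous F) (h : ∀ t, Complex.exp (F t) = 1)
    (s t : ℝ) : F s = F t := by
  have hd : ∀ t, ∃ n : ℤ, F t = n * (2 * Real.pi * Complex.I) := fun t =>
    Complex.exp_eq_one_iff.1 (h t)
  choose n hn using hd
  have him : ∀ t, (F t).im / (2 * Real.pi) = n t := by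
    intro t
    rw [hn t]
    have : (2 * Real.pi) ≠ 0 := by positivity
    field_simp
    simp
    ring
  have hcont : Continuous fun t => ((n t : ℤ) : ℝ) := by
    simp_rw [← him]
    fun_prop
  have hn' : Continuous n := by
    rw [Int.isClosedEmbedding_coe_real.isInducing.continuous_iff]
    exact hcont
  have : n s = n t := by
    have := PreconnectedSpace.constant (inferInstance : PreconnectedSpace ℝ) hn' (x := s) (y := t)
    exact this
  rw [hn, hn, this]

/-- There is no continuous branch of the logarithm on a circle around the origin. -/
theorem not_continuousOn_log_circle {r : ℝ} (hr : 0 < r) {h : ℂ → ℂ}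
    (hc : ContinuousOn h (Metric.sphere 0 r))
    (he : ∀ e ∈ Metric.sphere (0 : ℂ) r, Complex.exp (h e) = e) : False := by
  have hmem : ∀ t : ℝ, (r : ℂ) * Complex.exp (t * Complex.I) ∈ Metric.sphere (0 : ℂ) r := by
    intro t
    simp [Complex.norm_exp_ofReal_mul_I, abs_of_pos hr]
  have hr0 : (r : ℂ) ≠ 0 := by exact_mod_cast hr.ne'
  have hcont : Continuous fun t : ℝ =>
      h (r * Complex.exp (t * Complex.I)) - Complex.log r - t * Complex.I := by
    have : Continuous fun t : ℝ => h (r * Complex.exp (t * Complex.I)) :=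
      hc.comp_continuous (by fun_prop) hmem
    exact (this.sub continuous_const).sub (by fun_prop)
  have hone : ∀ t : ℝ, Complex.exp
      (h (r * Complex.exp (t * Complex.I)) - Complex.log r - t * Complex.I) = 1 := by
    intro t
    rw [Complex.exp_sub, Complex.exp_sub, he _ (hmem t), Complex.exp_log hr0]
    field_simp [Complex.exp_ne_zero]
  have h1 := eq_of_exp_eq_one hcont hone 0 (2 * Real.pi)
  have h2 : Complex.exp (((2 * Real.pi : ℝ) : ℂ) * Complex.I) = 1 := by
    push_cast
    exact Complex.exp_two_pi_mul_I
  rw [h2] at h1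
  have h3 := congrArg Complex.im h1
  simp only [Complex.ofReal_zero, zero_mul, Complex.exp_zero, mul_one, sub_zero, Complex.sub_im,
    Complex.mul_im, Complex.ofReal_re, Complex.I_im, Complex.ofReal_im, Complex.I_re, mul_zero,
    add_zero] at h3
  linarith [Real.pi_pos]

/-- If a disk of the plane is bounded by a round circle, then it covers the round disk: otherwise
it would be disjoint from a point `p` inside, and `ψ - p` would have a continuous logarithm on the
disk, whence a continuous logarithm on the circle. -/
theorem closedBall_subset_image_disk {ψ : ℂ → ℂ} {r : ℝ} (hr : 0 < r)
    (hc : ContinuousOn ψ disk) (hi : Set.InjOn ψ disk)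
    (hs : ψ '' Metric.sphere 0 1 = Metric.sphere 0 r) :
    Metric.closedBall 0 r ⊆ ψ '' disk := by
  intro p hp
  by_contra hpψ
  have hsub : Metric.sphere (0 : ℂ) 1 ⊆ disk := Metric.sphere_subset_closedBall
  have hpr : ‖p‖ < r := by
    rcases lt_or_eq_of_le (mem_closedBall_zero_iff.1 hp) with h | h
    · exact h
    · exfalso
      have : p ∈ ψ '' Metric.sphere 0 1 := by rw [hs]; simpa using h
      exact hpψ (Set.image_mono hsub this)
  -- the radial retraction of the plane onto the disk
  let c : ℂ → ℂ := fun x => (max 1 ‖x‖)⁻¹ • x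
  have hcc : Continuous c := by
    have h1 : Continuous fun x : ℂ => max 1 ‖x‖ := continuous_const.max continuous_norm
    exact (h1.inv₀ fun x => (lt_max_of_lt_left one_pos).ne').smul continuous_id
  have hcd : ∀ x, c x ∈ disk := by
    intro x
    have : 0 < max 1 ‖x‖ := by positivity
    simp only [c, disk, mem_closedBall_zero_iff, norm_smul, norm_inv, Real.norm_eq_abs,
      abs_of_pos this]
    rw [inv_mul_le_iff₀ this]
    simp
  have hcs : ∀ x ∈ Metric.sphere (0 : ℂ) 1, c x = x := by
    intro x hx
    have : ‖x‖ = 1 := by simpa using hx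
    simp [c, this]
  have hψc : Continuous fun x => ψ (c x) - p :=
    (hc.comp_continuous hcc hcd).sub continuous_const
  have huniv : IsSimplyConnected (Set.univ : Set ℂ) := by
    have : ContractibleSpace (Set.univ : Set ℂ) :=
      convex_univ.contractibleSpace Set.univ_nonempty
    exact (inferInstance : SimplyConnectedSpace (Set.univ : Set ℂ))
  obtain ⟨f, hf, hfe⟩ := Complex.exists_continuousOn_eqOn_exp_comp huniv isOpen_univ
    hψc.continuousOn (by
      rintro ⟨x, -, hx⟩
      exact hpψ ⟨c x, hcd x, sub_eq_zero.1 hx⟩)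
  have hκ := continuousOn_invFunOn_of_isCompact (isCompact_sphere (0 : ℂ) 1) (hc.mono hsub)
    (hi.mono hsub)
  set κ := Function.invFunOn ψ (Metric.sphere 0 1) with hκd
  rw [hs] at hκ
  have hκm : ∀ e ∈ Metric.sphere (0 : ℂ) r, κ e ∈ Metric.sphere (0 : ℂ) 1 ∧ ψ (κ e) = e := by
    intro e he
    rw [← hs] at he
    exact ⟨Function.invFunOn_mem he, Function.invFunOn_eq he⟩
  -- `e - p = e (1 - p / e)` turns a logarithm of `e - p` into one of `e`
  have hslit : ∀ e ∈ Metric.sphere (0 : ℂ) r, 1 - p / e ∈ Complex.slitPlane := by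
    intro e he
    have her : ‖e‖ = r := by simpa using he
    left
    have h1 : (p / e).re ≤ ‖p / e‖ := Complex.re_le_norm _
    have h2 : ‖p / e‖ < 1 := by
      rw [norm_div, her, div_lt_one hr]
      exact hpr
    simp only [Complex.sub_re, Complex.one_re]
    linarith
  have he0 : ∀ e ∈ Metric.sphere (0 : ℂ) r, e ≠ 0 := by
    rintro e he rfl
    simp at he
    exact hr.ne he
  refine not_continuousOn_log_circle hr (h := fun e => f (κ e) - Complex.log (1 - p / e)) ?_ ?_
  · refine ContinuousOn.sub (hf.comp hκ fun _ _ => Set.mem_univ _) (ContinuousOn.clog ?_ hslit)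
    exact continuousOn_const.sub (continuousOn_const.div continuousOn_id he0)
  · intro e he
    have h1 : Complex.exp (f (κ e)) = ψ (c (κ e)) - p := hfe (Set.mem_univ (κ e))
    rw [hcs _ (hκm e he).1, (hκm e he).2] at h1
    rw [Complex.exp_sub, h1, Complex.exp_log (Complex.slitPlane_ne_zero (hslit e he))]
    have h2 := he0 e he
    have h3 : e - p ≠ 0 := by
      intro h
      have := Complex.slitPlane_ne_zero (hslit e he)
      rw [sub_eq_zero] at h
      rw [← h, div_self h2] at this
      exact this (sub_self 1)
    have h4 : 1 - p / e = (e - p) / e := by field_simp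
    rw [h4]
    field_simp

/-- A disk of the plane bounded by a round circle is the round disk. -/
theorem image_disk_eq_closedBall {ψ : ℂ → ℂ} {r : ℝ} (hr : 0 < r)
    (hc : ContinuousOn ψ disk) (hi : Set.InjOn ψ disk)
    (hs : ψ '' Metric.sphere 0 1 = Metric.sphere 0 r) :
    ψ '' disk = Metric.closedBall 0 r := by
  have hsup := closedBall_subset_image_disk hr hc hi hs
  have hsub : Metric.sphere (0 : ℂ) 1 ⊆ disk := Metric.sphere_subset_closedBall
  have hball : Metric.ball (0 : ℂ) 1 ⊆ disk := Metric.ball_subset_closedBall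
  refine Set.Subset.antisymm ?_ hsup
  rintro _ ⟨x, hx, rfl⟩
  by_contra hxr
  rw [mem_closedBall_zero_iff, not_le] at hxr
  have hmem : ∀ y ∈ disk, ‖ψ y‖ ≠ r → y ∈ Metric.ball (0 : ℂ) 1 := by
    intro y hy hyr
    rcases lt_or_eq_of_le (mem_closedBall_zero_iff.1 hy) with h | h
    · simpa using h
    · exfalso
      have : ψ y ∈ Metric.sphere (0 : ℂ) r := by
        rw [← hs]
        exact ⟨y, by simpa using h, rfl⟩
      exact hyr (by simpa using this)
  obtain ⟨x₁, hx₁, h0⟩ := hsup (Metric.mem_closedBall_self hr.le)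
  have hx₁b := hmem x₁ hx₁ (by rw [h0, norm_zero]; exact hr.ne)
  have hxb := hmem x hx hxr.ne'
  have hpre : IsPreconnected (Metric.ball (0 : ℂ) 1) := Metric.isPreconnected_ball
  obtain ⟨y, hy, hyr⟩ := hpre.intermediate_value hx₁b hxb (hc.mono hball).norm
    (show r ∈ Set.Icc ‖ψ x₁‖ ‖ψ x‖ from ⟨by rw [h0, norm_zero]; exact hr.le, hxr.le⟩)
  have : ψ y ∈ ψ '' Metric.sphere 0 1 := by rw [hs]; simpa using hyr
  obtain ⟨y', hy', hyy⟩ := this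
  have := hi (hsub hy') (hball hy) hyy
  subst this
  simp only [mem_sphere_iff_norm, sub_zero, mem_ball_iff_norm] at hy' hy
  linarith

/-! ### The rotations induced on the circles of large radius -/

theorem rot_mul (θ : ℝ) (c z : ℂ) : rot θ (c * z) = c * rot θ z := by
  simp only [rot]
  ring

theorem norm_exp_rot (θ : ℝ) : ‖Complex.exp (2 * Real.pi * θ * Complex.I)‖ = 1 := by
  have : (2 * Real.pi * θ * Complex.I : ℂ) = ((2 * Real.pi * θ : ℝ) : ℂ) * Complex.I := by
    push_cast; ring
  rw [this, Complex.norm_exp_ofReal_mul_I]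

theorem norm_rot (θ : ℝ) (z : ℂ) : ‖rot θ z‖ = ‖z‖ := by
  rw [rot, norm_mul, norm_exp_rot, one_mul]

theorem rot_add (θ θ' : ℝ) (z : ℂ) : rot θ (rot θ' z) = rot (θ + θ') z := by
  simp only [rot]
  rw [← mul_assoc, ← Complex.exp_add]
  congr 2
  push_cast
  ring

/-- The angle, in turns, of the rotation that `F` induces on the circle of centre `0` and radius
`s`. -/
noncomputable def angle (F : ℂ → ℂ) (s : ℝ) : ℝ := Complex.arg (F s / s) / (2 * Real.pi)

/-- An untwisted map that rotates a circle around the origin does so by less than a quarter turn: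
the preimage of `(X, 0)` has a first coordinate that increases with `X`. -/
theorem IsUntwisted.cos_pos {F : ℂ ≃ₜ ℂ} {g g' : ℝ → ℝ → ℝ} (h : IsUntwisted F g g') {s θ : ℝ}
    (hs : 0 < s) (hθ : ∀ z : ℂ, ‖z‖ = s → F z = rot θ z) :
    0 < (Complex.exp (2 * Real.pi * θ * Complex.I)).re := by
  set w := Complex.exp (2 * Real.pi * θ * Complex.I) with hw
  have key : ∀ u : ℝ, |u| = s → u = g (w.re * u) 0 := by
    intro u hu
    have h1 : F ⟨u, 0⟩ = ⟨w.re * u, w.im * u⟩ := by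
      rw [hθ]
      · simp only [rot]
        rw [← hw]
        apply Complex.ext <;> simp
      · have : (⟨u, 0⟩ : ℂ) = (u : ℂ) := rfl
        rw [this, Complex.norm_real]
        exact hu
    exact ((h.map_eq_iff _ _ _ _).1 h1).1
  by_contra hneg
  have h1 := key s (abs_of_pos hs)
  have h2 := key (-s) (by rw [abs_neg, abs_of_pos hs])
  have h3 : w.re * s ≤ w.re * -s := by nlinarith
  have h4 : g (w.re * s) 0 ≤ g (w.re * -s) 0 := (h.strictMono_left 0).monotone h3
  linarith

theorem exp_angle {F : ℂ → ℂ} {s θ : ℝ} (hs : 0 < s) (hθ : ∀ z : ℂ, ‖z‖ = s → F z = rot θ z) :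
    Complex.exp (2 * Real.pi * angle F s * Complex.I) =
      Complex.exp (2 * Real.pi * θ * Complex.I) := by
  have hs0 : (s : ℂ) ≠ 0 := by exact_mod_cast hs.ne'
  have h1 : F s / s = Complex.exp (2 * Real.pi * θ * Complex.I) := by
    rw [hθ s (by rw [Complex.norm_real]; exact abs_of_pos hs), rot]
    field_simp
  have h2 : (2 * Real.pi * angle F s * Complex.I : ℂ) = Complex.arg (F s / s) * Complex.I := by
    rw [angle]
    push_cast
    have : (Real.pi : ℂ) ≠ 0 := by exact_mod_cast Real.pi_ne_zero
    field_simp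
  rw [h2, h1]
  conv_rhs => rw [← Complex.norm_mul_exp_arg_mul_I (Complex.exp (2 * Real.pi * θ * Complex.I))]
  rw [norm_exp_rot]
  simp

theorem apply_eq_rot_angle {F : ℂ → ℂ} {s θ : ℝ} (hs : 0 < s)
    (hθ : ∀ z : ℂ, ‖z‖ = s → F z = rot θ z) (z : ℂ) (hz : ‖z‖ = s) : F z = rot (angle F s) z := by
  rw [hθ z hz, rot, rot, exp_angle hs hθ]

theorem IsUntwisted.re_div_pos {F : ℂ ≃ₜ ℂ} {g g' : ℝ → ℝ → ℝ} (h : IsUntwisted F g g') {s θ : ℝ}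
    (hs : 0 < s) (hθ : ∀ z : ℂ, ‖z‖ = s → F z = rot θ z) : 0 < (F s / s).re := by
  have hs0 : (s : ℂ) ≠ 0 := by exact_mod_cast hs.ne'
  rw [hθ s (by rw [Complex.norm_real]; exact abs_of_pos hs), rot, mul_div_cancel_right₀ _ hs0]
  exact h.cos_pos hs hθ

theorem IsUntwisted.abs_angle_lt {F : ℂ ≃ₜ ℂ} {g g' : ℝ → ℝ → ℝ} (h : IsUntwisted F g g')
    {s θ : ℝ} (hs : 0 < s) (hθ : ∀ z : ℂ, ‖z‖ = s → F z = rot θ z) : |angle F s| < 1 / 4 := by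
  have h1 := Complex.abs_arg_lt_pi_div_two_iff.2 (Or.inl (h.re_div_pos hs hθ))
  rw [angle, abs_div, abs_of_pos (by positivity : (0 : ℝ) < 2 * Real.pi),
    div_lt_iff₀ (by positivity)]
  linarith

theorem IsUntwisted.continuousOn_angle {F : ℂ ≃ₜ ℂ} {g g' : ℝ → ℝ → ℝ} (h : IsUntwisted F g g')
    (hrot : ∀ s : ℝ, 1 ≤ s → ∃ θ : ℝ, ∀ z : ℂ, ‖z‖ = s → F z = rot θ z) :
    ContinuousOn (angle F) (Set.Ici 1) := by
  intro s hs
  obtain ⟨θ, hθ⟩ := hrot s hs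
  have hs' : (0 : ℝ) < s := lt_of_lt_of_le one_pos hs
  have hs0 : (s : ℂ) ≠ 0 := by exact_mod_cast hs'.ne'
  have h1 : ContinuousAt (fun s : ℝ => F s / (s : ℂ)) s := by
    refine ContinuousAt.div ?_ Complex.continuous_ofReal.continuousAt hs0
    exact (F.continuous.comp Complex.continuous_ofReal).continuousAt
  have h2 : ContinuousAt (fun s : ℝ => Complex.arg (F s / s)) s :=
    ContinuousAt.comp (f := fun s : ℝ => F s / (s : ℂ))
      (Complex.continuousAt_arg (Or.inl (h.re_div_pos hs' hθ))) h1
  exact (h2.div_const _).continuousWithinAt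

/-- The angle of a rotation is determined by the rotation once it is less than half a turn. -/
theorem angle_eq {F : ℂ → ℂ} {s θ : ℝ} (hs : 0 < s) (hθ : ∀ z : ℂ, ‖z‖ = s → F z = rot θ z)
    (hlt : |θ| < 1 / 4) : angle F s = θ := by
  have hs0 : (s : ℂ) ≠ 0 := by exact_mod_cast hs.ne'
  have hπ := Real.pi_pos
  rw [abs_lt] at hlt
  rw [angle, hθ s (by rw [Complex.norm_real]; exact abs_of_pos hs), rot,
    mul_div_cancel_right₀ _ hs0]
  have : (2 * Real.pi * θ * Complex.I : ℂ) = ((2 * Real.pi * θ : ℝ) : ℂ) * Complex.I := by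
    push_cast; ring
  rw [this, Complex.arg_exp_mul_I, toIocMod_eq_self (Real.two_pi_pos) |>.2]
  · field_simp
  · constructor <;> nlinarith

section

variable {K : ℝ≥0} {α β : ℝ} {F : ℂ → ℂ} {m b : ℕ} {f : ℤ → ℂ ≃ₜ ℂ} {g g' : ℤ → ℝ → ℝ → ℝ}

theorem IsDecomposition.apply_eq (hf : IsDecomposition K α F m f g g') {s : ℝ} (hs : 1 ≤ s) (i : ℤ)
    (z : ℂ) (hz : ‖z‖ = s) : f i z = rot (angle (f i) s) z := by
  obtain ⟨θ, hθ⟩ := hf.rotation i s hs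
  exact apply_eq_rot_angle (lt_of_lt_of_le one_pos hs) hθ z hz

theorem IsDecomposition.abs_angle_lt (hf : IsDecomposition K α F m f g g') {s : ℝ} (hs : 1 ≤ s)
    (i : ℤ) : |angle (f i) s| < 1 / 4 := by
  obtain ⟨θ, hθ⟩ := hf.rotation i s hs
  exact (hf.untwisted i).abs_angle_lt (lt_of_lt_of_le one_pos hs) hθ

theorem IsDecomposition.comp_apply (hf : IsDecomposition K α F m f g g') {s : ℝ} (hs : 1 ≤ s)
    (n : ℕ) (z : ℂ) (hz : ‖z‖ = s) :
    comp f n z = rot (∑ j ∈ Finset.range n, angle (f (j + 1)) s) z := by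
  induction n with
  | zero => simp [comp, rot]
  | succ n ih =>
    change f (n + 1) (comp f n z) = _
    rw [ih, hf.apply_eq hs _ _ (by rw [norm_rot, hz]), rot_add, Finset.sum_range_succ, add_comm]

/-- The total angle of the isotopy on the circle of radius `s`. It is known up to an integer from
the values of `F` on the circle; that integer is `0` on the unit circle and does not depend on
`s`. -/
theorem IsDecomposition.sum_angle {f₀ : ℂ → ℂ} (hf : IsDecomposition K α (extendMap f₀ α β) m f g g')
    (hα : ∀ z : ℂ, ‖z‖ = 1 → f₀ z = rot α z) {r : ℝ} (hr : 1 ≤ r) (hrβ : r ≤ 1 + β - α) :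
    ∑ j ∈ Finset.range m, angle (f (j + 1)) r = α + r - 1 := by
  set T : ℝ → ℝ := fun s => ∑ j ∈ Finset.range m, angle (f (j + 1)) s with hT
  have hTc : ContinuousOn T (Set.Ici 1) := continuousOn_finsetSum _ fun j _ =>
    (hf.untwisted _).continuousOn_angle (hf.rotation _)
  have hT1 : T 1 = α := by
    obtain ⟨ρ, hρ, hsum⟩ := hf.rotation_number
    rw [← hsum]
    exact Finset.sum_congr rfl fun j _ => angle_eq one_pos (hρ _).2 (hρ _).1
  have hexp : ∀ s, 1 ≤ s → s ≤ r →
      Complex.exp (2 * Real.pi * (T s - (α + s - 1) : ℝ) * Complex.I) = 1 := by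
    intro s hs hsr
    have hs0 : (s : ℂ) ≠ 0 := by exact_mod_cast (lt_of_lt_of_le one_pos hs).ne'
    have hns : ‖(s : ℂ)‖ = s := by
      rw [Complex.norm_real]
      exact abs_of_pos (lt_of_lt_of_le one_pos hs)
    have h1 := hf.comp_apply hs m s hns
    have h2 : comp f m s = rot (α + s - 1) s := by
      rw [hf.comp_eq, extendMap, hns]
      rcases eq_or_lt_of_le hs with h | h
      · subst h
        rw [if_pos le_rfl, hα _ (by simp)]
        congr 1
        ring
      · rw [if_neg h.not_ge, if_pos (hsr.trans hrβ)]
    rw [h1, rot, rot] at h2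
    have h3 := mul_right_cancel₀ hs0 h2
    have h4 : (2 * Real.pi * (T s - (α + s - 1) : ℝ) * Complex.I : ℂ) =
        2 * Real.pi * (T s : ℝ) * Complex.I - 2 * Real.pi * (α + s - 1 : ℝ) * Complex.I := by
      push_cast
      ring
    rw [h4, Complex.exp_sub, h3, div_self (Complex.exp_ne_zero _)]
  -- the clamped parameter runs over `[1, r]`
  set cl : ℝ → ℝ := fun t => max 1 (min t r) with hcl
  have hcl1 : ∀ t, 1 ≤ cl t := fun t => le_max_left _ _
  have hclr : ∀ t, cl t ≤ r := fun t => max_le hr (min_le_right _ _)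
  have hclc : Continuous cl := continuous_const.max (continuous_id.min continuous_const)
  have hTcl : Continuous fun t => T (cl t) := hTc.comp_continuous hclc hcl1
  have hFc : Continuous fun t : ℝ =>
      (2 * Real.pi * (T (cl t) - (α + cl t - 1) : ℝ) * Complex.I : ℂ) := by
    have h1 : Continuous fun t => T (cl t) - (α + cl t - 1) :=
      hTcl.sub ((continuous_const.add hclc).sub continuous_const)
    exact (continuous_const.mul (Complex.continuous_ofReal.comp h1)).mul continuous_const
  have h := eq_of_exp_eq_one hFc (fun t => hexp _ (hcl1 t) (hclr t)) 1 r
  have e1 : cl 1 = 1 := by simp [hcl]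
  have er : cl r = r := by simp [hcl, hr]
  rw [e1, er, hT1] at h
  have h2πI : (2 * Real.pi : ℂ) ≠ 0 := by
    have : (Real.pi : ℂ) ≠ 0 := by exact_mod_cast Real.pi_ne_zero
    exact mul_ne_zero two_ne_zero this
  have h5 := mul_left_cancel₀ h2πI (mul_right_cancel₀ Complex.I_ne_zero h)
  have h6 : α - (α + 1 - 1) = T r - (α + r - 1) := by exact_mod_cast h5
  have h7 : T r = α + r - 1 := by linarith
  exact h7

/-! ### The singular curve -/

theorem IsDecomposition.zeta_eq_zero_iff (hf : IsDecomposition K α F m f g g') (z : ℤ → ℂ) :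
    zeta g g' z = 0 ↔ ∀ i, f i (z i) = z (i + 1) := by
  have key : ∀ i, f i (z i) = z (i + 1) ↔
      (z i).re = g i (z (i + 1)).re (z i).im ∧ (z (i + 1)).im = g' i (z (i + 1)).re (z i).im :=
    fun i => (hf.untwisted i).map_eq_iff (z i).re (z i).im (z (i + 1)).re (z (i + 1)).im
  simp_rw [key]
  constructor
  · intro h i
    have h1 := congrArg Complex.im (congrFun h i)
    have h2 := congrArg Complex.re (congrFun h (i + 1))
    simp only [zeta, Pi.zero_apply, Complex.zero_im, Complex.zero_re, add_sub_cancel_right] at h1 h2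
    exact ⟨sub_eq_zero.1 h1, sub_eq_zero.1 h2⟩
  · intro h
    funext i
    apply Complex.ext
    · have := (h (i - 1)).2
      simp only [sub_add_cancel] at this
      simp only [zeta, Pi.zero_apply, Complex.zero_re]
      linarith
    · have := (h i).1
      simp only [zeta, Pi.zero_apply, Complex.zero_im]
      linarith

theorem IsDecomposition.mul_mem_singularCurve (hf : IsDecomposition K α F m f g g') {a : ℤ}
    (hr : (1 : ℝ) ≤ 1 + a / b - α) {z : ℤ → ℂ} (hz : z ∈ singularCurve α m b g g' a) {c : ℂ}
    (hc : ‖c‖ = 1) : (fun i => c * z i) ∈ singularCurve α m b g g' a := by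
  obtain ⟨hE, h0, hn⟩ := hz
  refine ⟨fun i => congrArg (c * ·) (hE i), ?_, fun i => by rw [norm_mul, hc, one_mul, hn i]⟩
  rw [hf.zeta_eq_zero_iff] at h0 ⊢
  intro i
  rw [hf.apply_eq hr i _ (by rw [norm_mul, hc, one_mul, hn i]), rot_mul,
    ← hf.apply_eq hr i _ (hn i), h0 i]

theorem IsDecomposition.exists_mem_singularCurve (hf : IsDecomposition K α F m f g g') {a : ℤ}
    (hr : (1 : ℝ) ≤ 1 + a / b - α) (hne : (singularCurve α m b g g' a).Nonempty) (i : ℤ) {p : ℂ}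
    (hp : ‖p‖ = 1 + a / b - α) : ∃ z ∈ singularCurve α m b g g' a, z i = p := by
  obtain ⟨z, hz⟩ := hne
  have hn := hz.2.2 i
  have h0 : z i ≠ 0 := by
    intro h
    rw [h, norm_zero] at hn
    linarith
  refine ⟨_, hf.mul_mem_singularCurve hr hz (c := p / z i) ?_, ?_⟩
  · rw [norm_div, hp, hn, div_self (by linarith)]
  · field_simp

/-! ### Differences of points of the invariant disk -/

/-- A continuous function on the round disk which is injective on a chord, and increases from one
end of the chord to the other, is increasing on the chord. The chord is the set of the points
`pt x` of the disk. -/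
theorem lt_on_chord {r η : ℝ} {pt : ℝ → ℂ} (hpt : ∀ x, ‖pt x‖ ^ 2 = x ^ 2 + η ^ 2)
    (hptc : Continuous pt) {H : ℂ → ℝ} (hr : 0 < r) (hH : ContinuousOn H (Metric.closedBall 0 r))
    (hinj : ∀ x x', ‖pt x‖ ≤ r → ‖pt x'‖ ≤ r → H (pt x) = H (pt x') → x = x')
    (hbd : ∀ x x', ‖pt x‖ = r → ‖pt x'‖ = r → x < x' → H (pt x) < H (pt x')) {x x' : ℝ}
    (hx : ‖pt x‖ ≤ r) (hx' : ‖pt x'‖ ≤ r) (hlt : x < x') : H (pt x) < H (pt x') := by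
  have hle : ∀ u, ‖pt u‖ ≤ r ↔ u ^ 2 ≤ r ^ 2 - η ^ 2 := by
    intro u
    rw [← sq_le_sq₀ (norm_nonneg _) hr.le, hpt]
    constructor <;> intro h <;> linarith
  have hη : 0 ≤ r ^ 2 - η ^ 2 := le_trans (sq_nonneg x) ((hle x).1 hx)
  set l := √(r ^ 2 - η ^ 2) with hl
  have hl0 : 0 ≤ l := Real.sqrt_nonneg _
  have hl2 : l ^ 2 = r ^ 2 - η ^ 2 := Real.sq_sqrt hη
  have hIcc : ∀ u, ‖pt u‖ ≤ r ↔ u ∈ Set.Icc (-l) l := by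
    intro u
    rw [hle, ← hl2, Set.mem_Icc, sq_le_sq, abs_of_nonneg hl0, abs_le]
  have hend : ∀ u, u ^ 2 = l ^ 2 → ‖pt u‖ = r := by
    intro u hu
    have := hpt u
    rw [hu, hl2] at this
    rw [← sq_eq_sq₀ (norm_nonneg _) hr.le, this]
    ring
  have hmono : StrictMonoOn (fun u => H (pt u)) (Set.Icc (-l) l) := by
    refine ContinuousOn.strictMonoOn_of_injOn_Icc (by linarith) ?_ ?_ ?_
    · rcases hl0.eq_or_lt with h | h
      · rw [← h, neg_zero]
      · exact (hbd _ _ (hend _ (by ring)) (hend _ rfl) (by linarith)).le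
    · exact hH.comp hptc.continuousOn fun u hu => mem_closedBall_zero_iff.2 ((hIcc u).2 hu)
    · exact fun u hu v hv huv => hinj u v ((hIcc u).2 hu) ((hIcc v).2 hv) huv
  exact hmono ((hIcc x).1 hx) ((hIcc x').1 hx') hlt

variable {a : ℤ} {Δ : Set (ℤ → ℂ)}

/-- Each projection `z ↦ z_i` sends the invariant disk homeomorphically onto the round disk; the
inverse `Φ` sends the circle into the singular curve. -/
theorem IsInvariantDisk.exists_section (hf : IsDecomposition K α F m f g g')
    (hr : (1 : ℝ) ≤ 1 + a / b - α)
    (hΔ : IsInvariantDisk m b g g' (singularCurve α m b g g' a) Δ) (i : ℤ) :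
    ∃ Φ : ℂ → ℤ → ℂ, ContinuousOn Φ (Metric.closedBall 0 (1 + a / b - α)) ∧
      (∀ p, ‖p‖ ≤ 1 + a / b - α → Φ p ∈ Δ ∧ Φ p i = p) ∧
      (∀ z ∈ Δ, ‖z i‖ ≤ 1 + a / b - α ∧ Φ (z i) = z) ∧
      ∀ p, ‖p‖ = 1 + a / b - α → Φ p ∈ singularCurve α m b g g' a := by
  set r : ℝ := 1 + a / b - α with hrd
  have hr0 : 0 < r := lt_of_lt_of_le one_pos hr
  obtain ⟨φ, hφc, hφi, hφ, hφs⟩ := hΔ.isDisk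
  have hsub : Metric.sphere (0 : ℂ) 1 ⊆ disk := Metric.sphere_subset_closedBall
  have hne : (singularCurve α m b g g' a).Nonempty := by
    rw [← hφs]
    exact ⟨_, 1, by simp, rfl⟩
  have hc : ContinuousOn (fun x => φ x i) disk := (continuous_apply i).comp_continuousOn hφc
  have hi : Set.InjOn (fun x => φ x i) disk := by
    intro x hx y hy hxy
    refine hφi hx hy (hΔ.injOn_right i (hφ ▸ ⟨x, hx, rfl⟩) (hφ ▸ ⟨y, hy, rfl⟩) ?_)
    have hxy' : φ x i = φ y i := hxy
    simp only [hxy']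
  have hs : (fun x => φ x i) '' Metric.sphere 0 1 = Metric.sphere 0 r := by
    ext p
    constructor
    · rintro ⟨x, hx, rfl⟩
      have : φ x ∈ singularCurve α m b g g' a := hφs ▸ ⟨x, hx, rfl⟩
      simpa using this.2.2 i
    · intro hp
      obtain ⟨z, hz, hzp⟩ := hf.exists_mem_singularCurve hr hne i (p := p) (by simpa using hp)
      rw [← hφs] at hz
      obtain ⟨x, hx, rfl⟩ := hz
      exact ⟨x, hx, hzp⟩
  have him := image_disk_eq_closedBall hr0 hc hi hs
  have hinv := continuousOn_invFunOn_of_isCompact (isCompact_closedBall (0 : ℂ) 1) hc hi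
  have hsec : ∀ z ∈ Δ, φ (Function.invFunOn (fun x => φ x i) disk (z i)) = z := by
    intro z hz
    rw [← hφ] at hz
    obtain ⟨x, hx, rfl⟩ := hz
    exact congrArg φ (hi.leftInvOn_invFunOn hx)
  have hmem : ∀ p : ℂ, ‖p‖ ≤ r → p ∈ (fun x => φ x i) '' disk := by
    intro p hp
    rw [him]
    simpa using hp
  refine ⟨fun p => φ (Function.invFunOn (fun x => φ x i) disk p), ?_, ?_, ?_, ?_⟩
  · rw [← him]
    exact hφc.comp hinv fun p hp => Function.invFunOn_mem hp
  · intro p hp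
    refine ⟨?_, Function.invFunOn_eq (hmem p hp)⟩
    rw [← hφ]
    exact ⟨_, Function.invFunOn_mem (hmem p hp), rfl⟩
  · intro z hz
    refine ⟨?_, hsec z hz⟩
    rw [← hφ] at hz
    obtain ⟨x, hx, rfl⟩ := hz
    have : φ x i ∈ Metric.closedBall (0 : ℂ) r := him ▸ ⟨x, hx, rfl⟩
    simpa using this
  · intro p hp
    obtain ⟨z, hz, rfl⟩ := hf.exists_mem_singularCurve hr hne i hp
    have hzΔ : z ∈ Δ := by
      rw [← hφ]
      rw [← hφs] at hz
      exact Set.image_mono hsub hz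
    have := hsec z hzΔ
    simp only
    rwa [this]

/-- On the invariant disk `x_{i+1}` is an increasing function of `x_i` when `y_i` is fixed. It is
injective on each full horizontal chord of the round disk of the points `z_i`, and increases from
one end of the chord to the other, because the ends belong to the singular curve. -/
theorem IsInvariantDisk.re_lt (hf : IsDecomposition K α F m f g g')
    (hr : (1 : ℝ) ≤ 1 + a / b - α)
    (hΔ : IsInvariantDisk m b g g' (singularCurve α m b g g' a) Δ) (i : ℤ) {z w : ℤ → ℂ}
    (hz : z ∈ Δ) (hw : w ∈ Δ) (him : (z i).im = (w i).im) (hre : (z i).re < (w i).re) :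
    (z (i + 1)).re < (w (i + 1)).re := by
  obtain ⟨Φ, hΦc, hΦ, hΔΦ, hΦs⟩ := hΔ.exists_section hf hr i
  have key := lt_on_chord (r := 1 + a / b - α) (η := (z i).im) (pt := fun x => ⟨x, (z i).im⟩)
    (H := fun p => (Φ p (i + 1)).re)
    (fun x => by rw [Complex.sq_norm, Complex.normSq_mk]; ring)
    (Complex.equivRealProdCLM.symm.continuous.comp (continuous_id.prodMk continuous_const))
    (lt_of_lt_of_le one_pos hr)
    (Complex.continuous_re.comp_continuousOn ((continuous_apply (i + 1)).comp_continuousOn hΦc))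
    ?_ ?_ (x := (z i).re) (x' := (w i).re) (hΔΦ z hz).1 (by rw [him]; exact (hΔΦ w hw).1) hre
  · have hw' : (⟨(w i).re, (z i).im⟩ : ℂ) = w i := by rw [him]
    have hz' : (⟨(z i).re, (z i).im⟩ : ℂ) = z i := rfl
    simp only [hw', hz', (hΔΦ z hz).2, (hΔΦ w hw).2] at key
    exact key
  · intro x x' hx hx' hH
    obtain ⟨h1, h2⟩ := hΦ _ hx
    obtain ⟨h1', h2'⟩ := hΦ _ hx'
    have h3 : Φ ⟨x, (z i).im⟩ = Φ ⟨x', (z i).im⟩ := by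
      refine hΔ.injOn_left (i + 1) h1 h1' ?_
      simp only [add_sub_cancel_right, h2, h2']
      rw [hH]
    rw [h3, h2'] at h2
    exact (congrArg Complex.re h2).symm
  · intro x x' hx hx' hxx
    have h0 := hΦs _ hx
    have h0' := hΦs _ hx'
    have h2 := (hΦ _ hx.le).2
    have h2' := (hΦ _ hx'.le).2
    have e := ((hf.untwisted i).map_eq_iff _ _ _ _).1
      ((hf.zeta_eq_zero_iff _).1 h0.2.1 i)
    have e' := ((hf.untwisted i).map_eq_iff _ _ _ _).1
      ((hf.zeta_eq_zero_iff _).1 h0'.2.1 i)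
    have e1 := e.1
    have e1' := e'.1
    rw [h2] at e1
    rw [h2'] at e1'
    refine ((hf.untwisted i).strictMono_left (z i).im).lt_iff_lt.1 ?_
    simp only at e1 e1' ⊢
    rwa [← e1, ← e1']

/-- On the invariant disk `y_{i-1}` is an increasing function of `y_i` when `x_i` is fixed. -/
theorem IsInvariantDisk.im_lt (hf : IsDecomposition K α F m f g g')
    (hr : (1 : ℝ) ≤ 1 + a / b - α)
    (hΔ : IsInvariantDisk m b g g' (singularCurve α m b g g' a) Δ) (i : ℤ) {z w : ℤ → ℂ}
    (hz : z ∈ Δ) (hw : w ∈ Δ) (hre : (z i).re = (w i).re) (him : (z i).im < (w i).im) :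
    (z (i - 1)).im < (w (i - 1)).im := by
  obtain ⟨Φ, hΦc, hΦ, hΔΦ, hΦs⟩ := hΔ.exists_section hf hr i
  have key := lt_on_chord (r := 1 + a / b - α) (η := (z i).re) (pt := fun y => ⟨(z i).re, y⟩)
    (H := fun p => (Φ p (i - 1)).im)
    (fun x => by rw [Complex.sq_norm, Complex.normSq_mk]; ring)
    (Complex.equivRealProdCLM.symm.continuous.comp (continuous_const.prodMk continuous_id))
    (lt_of_lt_of_le one_pos hr)
    (Complex.continuous_im.comp_continuousOn ((continuous_apply (i - 1)).comp_continuousOn hΦc))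
    ?_ ?_ (x := (z i).im) (x' := (w i).im) (hΔΦ z hz).1 (by rw [hre]; exact (hΔΦ w hw).1) him
  · have hw' : (⟨(z i).re, (w i).im⟩ : ℂ) = w i := by rw [hre]
    have hz' : (⟨(z i).re, (z i).im⟩ : ℂ) = z i := rfl
    simp only [hw', hz', (hΔΦ z hz).2, (hΔΦ w hw).2] at key
    exact key
  · intro y y' hy hy' hH
    obtain ⟨h1, h2⟩ := hΦ _ hy
    obtain ⟨h1', h2'⟩ := hΦ _ hy'
    have h3 : Φ ⟨(z i).re, y⟩ = Φ ⟨(z i).re, y'⟩ := by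
      refine hΔ.injOn_left i h1 h1' ?_
      simp only [h2, h2']
      rw [hH]
    rw [h3, h2'] at h2
    exact (congrArg Complex.im h2).symm
  · intro y y' hy hy' hyy
    have h0 := hΦs _ hy
    have h0' := hΦs _ hy'
    have h2 := (hΦ _ hy.le).2
    have h2' := (hΦ _ hy'.le).2
    have e := (((hf.untwisted (i - 1)).map_eq_iff _ _ _ _).1
      ((hf.zeta_eq_zero_iff _).1 h0.2.1 (i - 1))).2
    have e' := (((hf.untwisted (i - 1)).map_eq_iff _ _ _ _).1
      ((hf.zeta_eq_zero_iff _).1 h0'.2.1 (i - 1))).2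
    rw [sub_add_cancel, h2] at e
    rw [sub_add_cancel, h2'] at e'
    refine ((hf.untwisted (i - 1)).strictMono_right (z i).re).lt_iff_lt.1 ?_
    simp only at e e' ⊢
    rwa [← e, ← e']

/-- Distinct points of the invariant disk differ by an element of `V'`. -/
theorem IsInvariantDisk.sub_mem (hf : IsDecomposition K α F m f g g')
    (hr : (1 : ℝ) ≤ 1 + a / b - α)
    (hΔ : IsInvariantDisk m b g g' (singularCurve α m b g g' a) Δ) {z w : ℤ → ℂ}
    (hz : z ∈ Δ) (hw : w ∈ Δ) (hzw : z ≠ w) : z - w ∈ V' m b := by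
  refine ⟨(E m b).sub_mem (hΔ.subset hz) (hΔ.subset hw), fun i => ⟨fun h => ?_, fun h => ?_⟩⟩
  · have hre : (z i).re = (w i).re := by simpa [sub_eq_zero] using h
    simp only [Pi.sub_apply, Complex.sub_im]
    rcases lt_trichotomy (z i).im (w i).im with h1 | h1 | h1
    · have h2 := hΔ.im_lt hf hr i hz hw hre h1
      exact mul_pos_of_neg_of_neg (by linarith) (by linarith)
    · exact absurd (hΔ.injOn_right i hz hw (by simp only [hre, h1])) hzw
    · have h2 := hΔ.im_lt hf hr i hw hz hre.symm h1
      exact mul_pos (by linarith) (by linarith)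
  · have him : (z i).im = (w i).im := by simpa [sub_eq_zero] using h
    simp only [Pi.sub_apply, Complex.sub_re]
    rcases lt_trichotomy (z i).re (w i).re with h1 | h1 | h1
    · have h2 := hΔ.re_lt hf hr i hz hw him h1
      exact mul_pos_of_neg_of_neg (by linarith) (by linarith)
    · exact absurd (hΔ.injOn_right i hz hw (by simp only [him, h1])) hzw
    · have h2 := hΔ.re_lt hf hr i hw hz him.symm h1
      exact mul_pos (by linarith) (by linarith)

theorem isPreconnected_disk_diff_singleton (p : ℂ) : IsPreconnected (disk \ {p}) := by
  rcases le_or_gt 1 ‖p‖ with hp | hp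
  · refine (Metric.isPreconnected_ball (x := (0 : ℂ)) (r := 1)).subset_closure ?_ ?_
    · intro x hx
      refine ⟨Metric.ball_subset_closedBall hx, ?_⟩
      rintro rfl
      rw [mem_ball_zero_iff] at hx
      linarith
    · rw [closure_ball _ one_ne_zero]
      exact Set.sdiff_subset
  · -- the radial retraction onto the disk sends the complement of `p` onto `disk \ {p}`
    let c : ℂ → ℂ := fun x => (max 1 ‖x‖)⁻¹ • x
    have hcc : Continuous c := by
      have h1 : Continuous fun x : ℂ => max 1 ‖x‖ := continuous_const.max continuous_norm
      exact (h1.inv₀ fun x => (lt_max_of_lt_left one_pos).ne').smul continuous_id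
    have h1 : IsPreconnected ({p}ᶜ : Set ℂ) := (isConnected_compl_singleton_of_one_lt_rank
      (by rw [Complex.rank_real_complex]; norm_num) p).isPreconnected
    have h2 : c '' {p}ᶜ = disk \ {p} := by
      have hin : ∀ x, ‖x‖ ≤ 1 → c x = x := by
        intro x hx
        simp [c, max_eq_left hx]
      have hout : ∀ x, 1 ≤ ‖x‖ → ‖c x‖ = 1 := by
        intro x hx
        simp only [c, max_eq_right hx, norm_smul, norm_inv, norm_norm]
        exact inv_mul_cancel₀ (by linarith)
      ext y
      constructor
      · rintro ⟨x, hx, rfl⟩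
        rcases le_total ‖x‖ 1 with h | h
        · rw [hin x h]
          exact ⟨mem_closedBall_zero_iff.2 h, hx⟩
        · refine ⟨mem_closedBall_zero_iff.2 (hout x h).le, fun h' => ?_⟩
          rw [Set.mem_singleton_iff] at h'
          have := hout x h
          rw [h'] at this
          linarith
      · rintro ⟨hy, hyp⟩
        exact ⟨y, hyp, hin y (mem_closedBall_zero_iff.1 hy)⟩
    rw [← h2]
    exact h1.image c hcc.continuousOn

theorem L_neg (z : ℤ → ℂ) : L m b (-z) = L m b z := by
  simp only [L, Pi.neg_apply, Complex.neg_re, Complex.neg_im, Left.sign_neg, SignType.coe_neg]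
  congr 1
  exact Finset.sum_congr rfl fun j _ => by ring

/-- The disk minus a point is connected and `L` is locally constant, so the linking number of `z`
and `w` does not depend on `z`. -/
theorem IsInvariantDisk.L_sub_eq (hf : IsDecomposition K α F m f g g')
    (hr : (1 : ℝ) ≤ 1 + a / b - α)
    (hΔ : IsInvariantDisk m b g g' (singularCurve α m b g g' a) Δ) {z z' w : ℤ → ℂ}
    (hz : z ∈ Δ) (hz' : z' ∈ Δ) (hw : w ∈ Δ) (hzw : z ≠ w) (hzw' : z' ≠ w) :
    L m b (z - w) = L m b (z' - w) := by
  have hmem := fun {z w} => hΔ.sub_mem hf hr (z := z) (w := w)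
  have hE := hΔ.subset
  obtain ⟨φ, hφc, hφi, hφ, -⟩ := hΔ.isDisk
  rw [← hφ] at hz hz' hw
  obtain ⟨x, hx, rfl⟩ := hz
  obtain ⟨x', hx', rfl⟩ := hz'
  obtain ⟨p, hp, rfl⟩ := hw
  have hΔm : ∀ y ∈ disk, φ y ∈ Δ := fun y hy => hφ ▸ ⟨y, hy, rfl⟩
  refine (isPreconnected_disk_diff_singleton p).induction₂
    (fun y y' => L m b (φ y - φ p) = L m b (φ y' - φ p)) ?_ (fun _ _ _ _ _ _ => Eq.trans)
    (fun _ _ _ _ => Eq.symm) ⟨hx, fun h => hzw (by rw [h])⟩ ⟨hx', fun h => hzw' (by rw [h])⟩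
  rintro y ⟨hy, hyp⟩
  have hV : φ y - φ p ∈ V' m b := hmem (hΔm y hy) (hΔm p hp) fun h => hyp (hφi hy hp h)
  have ht : Tendsto (fun y => φ y - φ p) (𝓝[disk \ {p}] y) (𝓝[E m b] (φ y - φ p)) := by
    refine tendsto_nhdsWithin_iff.2 ⟨?_, ?_⟩
    · exact (((hφc y hy).mono Set.sdiff_subset).sub continuousWithinAt_const)
    · filter_upwards [self_mem_nhdsWithin] with y' hy'
      exact (E m b).sub_mem (hE (hΔm y' hy'.1)) (hE (hΔm p hp))
  exact (ht.eventually (L_eventually_eq m b _ hV)).mono fun _ => Eq.symm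

/-- Linking numbers do not depend on the pair of points of the invariant disk. -/
theorem IsInvariantDisk.L_sub_eq_L (hf : IsDecomposition K α F m f g g')
    (hr : (1 : ℝ) ≤ 1 + a / b - α)
    (hΔ : IsInvariantDisk m b g g' (singularCurve α m b g g' a) Δ) {z w σ : ℤ → ℂ}
    (hz : z ∈ Δ) (hw : w ∈ Δ) (hσ : σ ∈ Δ) (hσ0 : σ ≠ 0) (hzw : z ≠ w) :
    L m b (z - w) = L m b σ := by
  have h0 : ∀ u ∈ Δ, u ≠ 0 → L m b u = L m b σ := by
    intro u hu hu0
    simpa using hΔ.L_sub_eq hf hr hu hσ hΔ.zero_mem hu0 hσ0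
  by_cases hw0 : w = 0
  · subst hw0
    simpa using h0 z hz hzw
  · rw [hΔ.L_sub_eq hf hr hz hΔ.zero_mem hw hzw (Ne.symm hw0), zero_sub, L_neg]
    exact h0 w hw hw0

end

/-! ### The linking number of the singular curve with the origin -/

theorem sign_sin_two_pi_mul {δ : ℝ} (h : |δ| < 1 / 2) :
    SignType.sign (Real.sin (2 * Real.pi * δ)) = SignType.sign δ := by
  have hπ := Real.pi_pos
  rw [abs_lt] at h
  rcases lt_trichotomy δ 0 with h0 | h0 | h0
  · rw [sign_neg h0, sign_neg]
    exact Real.sin_neg_of_neg_of_neg_pi_lt (by nlinarith) (by nlinarith)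
  · simp [h0]
  · rw [sign_pos h0, sign_pos]
    exact Real.sin_pos_of_pos_of_lt_pi (by nlinarith) (by nlinarith)

theorem floor_add_ceil {δ : ℝ} (h : |δ| < 1 / 2) (k : ℤ) :
    ((⌊(k + 2 * δ : ℝ)⌋ + ⌈(k + 2 * δ : ℝ)⌉ : ℤ) : ℝ) = 2 * k + (SignType.sign δ : ℝ) := by
  rw [abs_lt] at h
  rw [Int.floor_intCast_add, Int.ceil_intCast_add]
  rcases lt_trichotomy δ 0 with h0 | h0 | h0
  · have h1 : ⌊2 * δ⌋ = -1 := by rw [Int.floor_eq_iff]; push_cast; constructor <;> linarith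
    have h2 : ⌈2 * δ⌉ = 0 := by rw [Int.ceil_eq_iff]; push_cast; constructor <;> linarith
    rw [sign_neg h0, h1, h2, SignType.coe_neg_one]
    push_cast
    ring
  · simp [h0]
    ring
  · have h1 : ⌊2 * δ⌋ = 0 := by rw [Int.floor_eq_iff]; push_cast; constructor <;> linarith
    have h2 : ⌈2 * δ⌉ = 1 := by rw [Int.ceil_eq_iff]; push_cast; constructor <;> linarith
    rw [sign_pos h0, h1, h2, SignType.coe_one]
    push_cast
    ring

/-- A turn by less than a quarter crosses the horizontal axis at most once, at the half turn `k / 2`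
nearest to `Θ'`, and there the sign of the cosine is `(-1) ^ k`. The function
`Θ ↦ ⌊2Θ⌋ + ⌈2Θ⌉` counts the crossings twice, a point on the axis being half way through. -/
theorem sign_cos_mul_sub {Θ Θ' : ℝ} (h : |Θ' - Θ| < 1 / 4) :
    (SignType.sign (Real.cos (2 * Real.pi * Θ')) : ℝ) *
      ((SignType.sign (Real.sin (2 * Real.pi * Θ')) : ℝ) -
        (SignType.sign (Real.sin (2 * Real.pi * Θ)) : ℝ)) =
      ((⌊2 * Θ'⌋ + ⌈2 * Θ'⌉ : ℤ) : ℝ) - ((⌊2 * Θ⌋ + ⌈2 * Θ⌉ : ℤ) : ℝ) := by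
  have hπ := Real.pi_pos
  obtain ⟨k, hk⟩ : ∃ k : ℤ, |2 * Θ' - k| ≤ 1 / 2 := ⟨round (2 * Θ'), abs_sub_round _⟩
  obtain ⟨δ', hδ'⟩ : ∃ δ' : ℝ, δ' = Θ' - k / 2 := ⟨_, rfl⟩
  obtain ⟨δ, hδ⟩ : ∃ δ : ℝ, δ = Θ - k / 2 := ⟨_, rfl⟩
  have e' : 2 * Θ' = k + 2 * δ' := by rw [hδ']; ring
  have e : 2 * Θ = k + 2 * δ := by rw [hδ]; ring
  rw [abs_lt] at h
  rw [e', abs_le] at hk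
  have hd' : |δ'| < 1 / 2 := by rw [abs_lt]; constructor <;> linarith
  have hd : |δ| < 1 / 2 := by rw [abs_lt]; constructor <;> linarith
  have a' : 2 * Real.pi * Θ' = 2 * Real.pi * δ' + k * Real.pi := by rw [hδ']; ring
  have a : 2 * Real.pi * Θ = 2 * Real.pi * δ + k * Real.pi := by rw [hδ]; ring
  have hs : ((SignType.sign ((-1 : ℝ) ^ k) : SignType) : ℝ) *
      ((SignType.sign ((-1 : ℝ) ^ k) : SignType) : ℝ) = 1 := by
    rcases Int.even_or_odd k with hk | hk
    · simp [hk.neg_one_zpow]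
    · simp [hk.neg_one_zpow]
  rw [e', e, floor_add_ceil hd', floor_add_ceil hd, a', a, Real.cos_add_int_mul_pi,
    Real.sin_add_int_mul_pi, Real.sin_add_int_mul_pi, sign_mul, sign_mul, sign_mul,
    sign_sin_two_pi_mul hd', sign_sin_two_pi_mul hd]
  simp only [SignType.coe_mul]
  have hc : (SignType.sign (Real.cos (2 * Real.pi * δ')) : ℝ) *
      ((SignType.sign δ' : ℝ) - (SignType.sign δ : ℝ)) =
      (SignType.sign δ' : ℝ) - (SignType.sign δ : ℝ) := by
    by_cases hq : |δ'| < 1 / 4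
    · rw [abs_lt] at hq
      rw [sign_pos (Real.cos_pos_of_mem_Ioo ⟨by nlinarith, by nlinarith⟩)]
      simp
    · have : SignType.sign δ' = SignType.sign δ := by
        rw [not_lt] at hq
        rcases le_abs.1 hq with hq | hq
        · rw [sign_pos (by linarith : 0 < δ'), sign_pos (by linarith)]
        · rw [sign_neg (by linarith : δ' < 0), sign_neg (by linarith)]
      rw [this, sub_self, mul_zero]
  linear_combination (SignType.sign (Real.cos (2 * Real.pi * δ')) : ℝ) *
      ((SignType.sign δ' : ℝ) - (SignType.sign δ : ℝ)) * hs + hc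

section

variable {K : ℝ≥0} {α β : ℝ} {m b : ℕ} {f : ℤ → ℂ ≃ₜ ℂ} {g g' : ℤ → ℝ → ℝ → ℝ} {a : ℤ}

theorem sum_range_mul_of_periodic {θ : ℕ → ℝ} {m : ℕ} (h : ∀ j, θ (j + m) = θ j) (b : ℕ) :
    ∑ j ∈ Finset.range (m * b), θ j = b * ∑ j ∈ Finset.range m, θ j := by
  have h' : ∀ b j, θ (m * b + j) = θ j := by
    intro b
    induction b with
    | zero => simp
    | succ b ih =>
      intro j
      rw [show m * (b + 1) + j = (m * b + j) + m by ring, h, ih]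
  induction b with
  | zero => simp
  | succ b ih =>
    rw [mul_add, mul_one, Finset.sum_range_add, ih, Finset.sum_congr rfl fun j _ => h' b j]
    push_cast
    ring

/-- Along the singular curve the argument of `z_i` increases by `a` turns in one period, in steps
of less than a quarter turn. -/
theorem IsDecomposition.L_singularCurve {f₀ : ℂ → ℂ}
    (hf : IsDecomposition K α (extendMap f₀ α β) m f g g')
    (hα : ∀ z : ℂ, ‖z‖ = 1 → f₀ z = rot α z) (hb : 0 < b) (ha : b * α < a ∧ (a : ℝ) < b * β)
    {σ : ℤ → ℂ} (hσ : σ ∈ singularCurve α m b g g' a) : L m b σ = a := by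
  have hb' : (0 : ℝ) < b := by exact_mod_cast hb
  have ha1 : α < a / b := by rw [lt_div_iff₀ hb']; linarith
  have ha2 : (a : ℝ) / b < β := by rw [div_lt_iff₀ hb']; linarith
  obtain ⟨r, hr⟩ : ∃ r : ℝ, r = 1 + a / b - α := ⟨_, rfl⟩
  have hr1 : 1 ≤ r := by linarith
  have hsum := hf.sum_angle hα hr1 (by linarith : r ≤ 1 + β - α)
  obtain ⟨-, h0, hn⟩ := hσ
  rw [hf.zeta_eq_zero_iff] at h0
  obtain ⟨θ, hθ⟩ : ∃ θ : ℤ → ℝ, θ = fun i => angle (f i) r := ⟨_, rfl⟩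
  have hθp : ∀ i, θ (i + m) = θ i := fun i => by simp only [hθ, hf.periodic]
  have hstep : ∀ i, σ (i + 1) = rot (θ i) (σ i) := by
    intro i
    rw [← h0 i, hf.apply_eq hr1 i (σ i) (by rw [hn i, hr]), hθ]
  have hθlt : ∀ i, |θ i| < 1 / 4 := fun i => by rw [hθ]; exact hf.abs_angle_lt hr1 i
  -- the lifted argument, in turns
  obtain ⟨Θ, hΘ⟩ : ∃ Θ : ℕ → ℝ, Θ = fun n =>
    Complex.arg (σ 0) / (2 * Real.pi) + ∑ j ∈ Finset.range n, θ j := ⟨_, rfl⟩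
  have hΘs : ∀ n, Θ (n + 1) = Θ n + θ n := by
    intro n
    simp only [hΘ, Finset.sum_range_succ]
    ring
  have hσΘ : ∀ n : ℕ, σ n = r * Complex.exp ((2 * Real.pi * Θ n : ℝ) * Complex.I) := by
    intro n
    induction n with
    | zero =>
      have h1 : 2 * Real.pi * Θ 0 = Complex.arg (σ 0) := by
        have := Real.pi_pos.ne'
        simp only [hΘ, Finset.range_zero, Finset.sum_empty, add_zero]
        field_simp
      rw [h1]
      have h2 := Complex.norm_mul_exp_arg_mul_I (σ 0)
      rw [hn 0, ← hr] at h2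
      exact_mod_cast h2.symm
    | succ n ih =>
      push_cast at ih ⊢
      rw [hstep, ih, hΘs, rot, mul_left_comm, ← Complex.exp_add]
      push_cast
      congr 2
      ring
  have hrpos : 0 < r := by linarith
  have hre : ∀ n : ℕ, SignType.sign (σ n).re = SignType.sign (Real.cos (2 * Real.pi * Θ n)) := by
    intro n
    rw [hσΘ, Complex.re_ofReal_mul, Complex.exp_ofReal_mul_I_re, sign_mul, sign_pos hrpos, one_mul]
  have him : ∀ n : ℕ, SignType.sign (σ n).im = SignType.sign (Real.sin (2 * Real.pi * Θ n)) := by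
    intro n
    rw [hσΘ, Complex.im_ofReal_mul, Complex.exp_ofReal_mul_I_im, sign_mul, sign_pos hrpos, one_mul]
  have htel : ∑ j ∈ Finset.range (m * b), (SignType.sign (σ (j + 1)).re : ℝ) *
      ((SignType.sign (σ (j + 1)).im : ℝ) - (SignType.sign (σ j).im : ℝ)) =
      ((⌊2 * Θ (m * b)⌋ + ⌈2 * Θ (m * b)⌉ : ℤ) : ℝ) - ((⌊2 * Θ 0⌋ + ⌈2 * Θ 0⌉ : ℤ) : ℝ) := by
    rw [← Finset.sum_range_sub fun n => ((⌊2 * Θ n⌋ + ⌈2 * Θ n⌉ : ℤ) : ℝ)]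
    refine Finset.sum_congr rfl fun j _ => ?_
    have h1 := hre (j + 1)
    have h2 := him (j + 1)
    push_cast at h1 h2
    rw [h1, h2, him j, sign_cos_mul_sub]
    rw [hΘs, add_sub_cancel_left]
    exact hθlt j
  have htot : Θ (m * b) = Θ 0 + a := by
    have h1 : ∑ j ∈ Finset.range m, θ j = a / b := by
      have h2 := Finset.sum_range_sub (fun j : ℕ => θ j) m
      have h3 : θ (m : ℤ) = θ 0 := by simpa using hθp 0
      simp only [Finset.sum_sub_distrib, Nat.cast_zero, h3, sub_self] at h2
      have h4 : ∑ j ∈ Finset.range m, θ ((j + 1 : ℕ) : ℤ) = α + r - 1 := by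
        rw [← hsum]
        refine Finset.sum_congr rfl fun j _ => ?_
        rw [hθ]
        push_cast
        rfl
      rw [h4] at h2
      linarith
    have h5 := sum_range_mul_of_periodic (θ := fun j : ℕ => θ j) (m := m)
      (fun j => by push_cast; exact hθp j) b
    rw [h1] at h5
    have h6 : (b : ℝ) * (a / b) = a := by field_simp
    rw [h6] at h5
    simp only [hΘ, h5, Finset.range_zero, Finset.sum_empty, add_zero]
  have h7 : 2 * (Θ 0 + a) = 2 * Θ 0 + ((2 * a : ℤ) : ℝ) := by push_cast; ring
  rw [L, htel, htot, h7, Int.floor_add_intCast, Int.ceil_add_intCast]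
  push_cast
  ring

end

/-! ### Cyclic systems with positive coupling of nearest neighbours -/

/-- A family of increments `G_k`, with `G_k (0) = 0`, and of their derivatives `e_k` such that
`e_k (t) - e_k (0)` is a combination of `G_{k-1} (t)`, `G_k (t)` and `G_{k+1} (t)` whose
coefficients may depend on `t` in an arbitrary way, but are bounded by `C`, those of the two
neighbours being at least `1 / C`. -/
structure IsPositivelyCoupled (C : ℝ) (G e : ℤ → ℝ → ℝ) : Prop where
  map_zero : ∀ k, G k 0 = 0
  hasDerivAt : ∀ k t, HasDerivAt (G k) (e k t) t
  coupling : ∀ k t, ∃ B B' A : ℝ, (C⁻¹ ≤ B ∧ B ≤ C) ∧ (C⁻¹ ≤ B' ∧ B' ≤ C) ∧ |A| ≤ C ∧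
    e k t - e k 0 = B * G (k - 1) t + B' * G (k + 1) t + A * G k t

section

variable {C : ℝ} {G e : ℤ → ℝ → ℝ}

theorem IsPositivelyCoupled.neg (h : IsPositivelyCoupled C G e) :
    IsPositivelyCoupled C (fun k t => -G k t) (fun k t => -e k t) where
  map_zero k := by rw [h.map_zero, neg_zero]
  hasDerivAt k t := (h.hasDerivAt k t).neg
  coupling k t := by
    obtain ⟨B, B', A, hB, hB', hA, he⟩ := h.coupling k t
    exact ⟨B, B', A, hB, hB', hA, by linear_combination -he⟩

theorem IsPositivelyCoupled.reflect (h : IsPositivelyCoupled C G e) :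
    IsPositivelyCoupled C (fun k => G (-k)) (fun k => e (-k)) where
  map_zero k := h.map_zero _
  hasDerivAt k t := h.hasDerivAt _ t
  coupling k t := by
    obtain ⟨B, B', A, hB, hB', hA, he⟩ := h.coupling (-k) t
    refine ⟨B', B, A, hB', hB, hA, ?_⟩
    rw [show -(k - 1) = -k + 1 by ring, show -(k + 1) = -k - 1 by ring]
    linear_combination he

/-- Reversal of time preserves the sign of the coupling if every second coordinate is changed into
its opposite. -/
theorem IsPositivelyCoupled.reverse (h : IsPositivelyCoupled C G e) :
    IsPositivelyCoupled C (fun k t => (-1) ^ (k + 1) * G k (-t))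
      (fun k t => (-1) ^ k * e k (-t)) where
  map_zero k := by rw [neg_zero, h.map_zero, mul_zero]
  hasDerivAt k t := by
    have h1 := ((h.hasDerivAt k (-t)).comp t (hasDerivAt_neg t)).const_mul ((-1 : ℝ) ^ (k + 1))
    refine h1.congr_deriv ?_
    rw [zpow_add_one₀ (by norm_num)]
    ring
  coupling k t := by
    obtain ⟨B, B', A, hB, hB', hA, he⟩ := h.coupling k (-t)
    refine ⟨B, B', -A, hB, hB', by rwa [abs_neg], ?_⟩
    have h1 : ((-1 : ℝ)) ^ (k - 1 + 1) = (-1) ^ k := by rw [sub_add_cancel]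
    have h2 : ((-1 : ℝ)) ^ (k + 1 + 1) = (-1) ^ k := by
      rw [zpow_add_one₀ (by norm_num), zpow_add_one₀ (by norm_num)]
      ring
    rw [neg_zero, h1, h2, zpow_add_one₀ (by norm_num)]
    linear_combination (-1 : ℝ) ^ k * he

/-- A bound for the derivative by a power of `t` can be integrated. -/
theorem abs_le_pow_of_deriv {F F' : ℝ → ℝ} (h0 : F 0 = 0) (hF : ∀ t, HasDerivAt F (F' t) t) {r : ℕ}
    (h : ∃ M, ∀ᶠ t in 𝓝[>] (0 : ℝ), |F' t| ≤ M * t ^ r) :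
    ∃ M, ∀ᶠ t in 𝓝[>] (0 : ℝ), |F t| ≤ M * t ^ (r + 1) := by
  obtain ⟨M, hM⟩ := h
  refine ⟨M, ?_⟩
  obtain ⟨τ, hτ, hsub⟩ := mem_nhdsGT_iff_exists_Ioo_subset.1 hM
  filter_upwards [Ioo_mem_nhdsGT hτ] with t ht
  obtain ⟨c, hc, hslope⟩ := exists_hasDerivAt_eq_slope F F' ht.1
    (fun u _ => (hF u).continuousAt.continuousWithinAt) fun u _ => hF u
  have hc' : |F' c| ≤ M * c ^ r := hsub ⟨hc.1, hc.2.trans ht.2⟩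
  rw [h0, sub_zero, sub_zero, eq_div_iff ht.1.ne'] at hslope
  have hcr : 0 < c ^ r := pow_pos hc.1 r
  have hM0 : 0 ≤ M := by
    by_contra hneg
    push Not at hneg
    nlinarith [abs_nonneg (F' c)]
  rw [← hslope, abs_mul, abs_of_pos ht.1, pow_succ, ← mul_assoc]
  refine mul_le_mul_of_nonneg_right (hc'.trans ?_) ht.1.le
  exact mul_le_mul_of_nonneg_left (pow_le_pow_left₀ hc.1.le hc.2.le r) hM0

theorem pow_le_of_deriv {F F' : ℝ → ℝ} (h0 : F 0 = 0) (hF : ∀ t, HasDerivAt F (F' t) t) {r : ℕ}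
    (h : ∃ c > 0, ∀ᶠ t in 𝓝[>] (0 : ℝ), c * t ^ r ≤ F' t) :
    ∃ c > 0, ∀ᶠ t in 𝓝[>] (0 : ℝ), c * t ^ (r + 1) ≤ F t := by
  obtain ⟨c, hc, h⟩ := h
  refine ⟨c / (r + 1), by positivity, ?_⟩
  obtain ⟨τ, hτ, hsub⟩ := mem_nhdsGT_iff_exists_Ioo_subset.1 h
  filter_upwards [Ioo_mem_nhdsGT hτ] with t ht
  have hD : ∀ u, HasDerivAt (fun u => F u - c / (r + 1) * u ^ (r + 1)) (F' u - c * u ^ r) u := by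
    intro u
    have h1 := ((hasDerivAt_pow (r + 1) u).const_mul (c / (r + 1)))
    refine ((hF u).sub h1).congr_deriv ?_
    have : (r : ℝ) + 1 ≠ 0 := by positivity
    push_cast
    field_simp
  obtain ⟨u, hu, hslope⟩ := exists_hasDerivAt_eq_slope _ _ ht.1
    (fun u _ => (hD u).continuousAt.continuousWithinAt) fun u _ => hD u
  have hu' : c * u ^ r ≤ F' u := hsub ⟨hu.1, hu.2.trans ht.2⟩
  rw [h0, sub_zero, eq_div_iff ht.1.ne'] at hslope
  have : 0 ≤ (F' u - c * u ^ r) * t := mul_nonneg (by linarith) ht.1.le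
  rw [hslope] at this
  simp only [ne_eq, Nat.add_eq_zero_iff, one_ne_zero, and_false, not_false_eq_true, zero_pow,
    mul_zero, sub_zero] at this
  linarith

/-- If `e_l (0) = 0` for all `l` at distance less than `r` from `k`, then `G_k` vanishes at `0` to
the order `r + 1`. -/
theorem IsPositivelyCoupled.abs_le_pow (h : IsPositivelyCoupled C G e) (r : ℕ) (k : ℤ)
    (hk : ∀ l, |l - k| < r → e l 0 = 0) :
    ∃ M, ∀ᶠ t in 𝓝[>] (0 : ℝ), |G k t| ≤ M * t ^ (r + 1) := by
  induction r generalizing k with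
  | zero =>
    have h1 := (h.hasDerivAt k 0).isBigO_sub
    simp only [h.map_zero, sub_zero] at h1
    obtain ⟨M, hM⟩ := h1.bound
    refine ⟨M, ?_⟩
    filter_upwards [hM.filter_mono nhdsWithin_le_nhds, self_mem_nhdsWithin] with t ht ht0
    rw [Set.mem_Ioi] at ht0
    rw [Real.norm_eq_abs, Real.norm_eq_abs, abs_of_pos ht0] at ht
    simpa using ht
  | succ r ih =>
    have hC : ∀ {l : ℤ}, |l - k| ≤ 1 → ∀ l', |l' - l| < r → e l' 0 = 0 := by
      intro l hl l' hl'
      refine hk l' ?_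
      rw [abs_le] at hl
      rw [abs_lt] at hl' ⊢
      push_cast
      constructor <;> linarith
    obtain ⟨M₁, h₁⟩ := ih (k - 1) (hC (by simp))
    obtain ⟨M₂, h₂⟩ := ih (k + 1) (hC (by simp))
    obtain ⟨M₃, h₃⟩ := ih k (hC (by simp))
    refine abs_le_pow_of_deriv (h.map_zero k) (h.hasDerivAt k) ⟨C * (M₁ + M₂ + M₃), ?_⟩
    filter_upwards [h₁, h₂, h₃, self_mem_nhdsWithin] with t h₁ h₂ h₃ ht
    obtain ⟨B, B', A, hB, hB', hA, he⟩ := h.coupling k t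
    have hC0 : 0 ≤ C := (abs_nonneg A).trans hA
    have hCi : 0 ≤ C⁻¹ := inv_nonneg.2 hC0
    rw [hk k (by simp), sub_zero] at he
    rw [he]
    have b1 : |B * G (k - 1) t| ≤ C * (M₁ * t ^ (r + 1)) := by
      rw [abs_mul, abs_of_nonneg (hCi.trans hB.1)]
      exact mul_le_mul hB.2 h₁ (abs_nonneg _) hC0
    have b2 : |B' * G (k + 1) t| ≤ C * (M₂ * t ^ (r + 1)) := by
      rw [abs_mul, abs_of_nonneg (hCi.trans hB'.1)]
      exact mul_le_mul hB'.2 h₂ (abs_nonneg _) hC0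
    have b3 : |A * G k t| ≤ C * (M₃ * t ^ (r + 1)) := by
      rw [abs_mul]
      exact mul_le_mul hA h₃ (abs_nonneg _) hC0
    calc |B * G (k - 1) t + B' * G (k + 1) t + A * G k t|
        ≤ |B * G (k - 1) t| + |B' * G (k + 1) t| + |A * G k t| := abs_add_three _ _ _
      _ ≤ C * (M₁ * t ^ (r + 1)) + C * (M₂ * t ^ (r + 1)) + C * (M₃ * t ^ (r + 1)) := by gcongr
      _ = C * (M₁ + M₂ + M₃) * t ^ (r + 1) := by ring

/-- Positivity spreads: if `e_i (0) > 0`, and the nonzero `e_l (0)` which is next on the right is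
farther from `i + j` than `i` is, or is equally far and positive, then `G_{i+j}` is positive
for small positive times, and vanishes to the order `j + 1` exactly. -/
theorem IsPositivelyCoupled.pow_le (hC : 0 < C) (j : ℕ) {G e : ℤ → ℝ → ℝ}
    (h : IsPositivelyCoupled C G e) (i : ℤ) (hi : 0 < e i 0)
    (hz : ∀ l, i < l → l < i + 2 * j → e l 0 = 0) (hr : 0 ≤ e (i + 2 * j) 0) :
    ∃ c > 0, ∀ᶠ t in 𝓝[>] (0 : ℝ), c * t ^ (j + 1) ≤ G (i + j) t := by
  induction j generalizing G e i with
  | zero =>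
    refine ⟨e i 0 / 2, by positivity, ?_⟩
    have h1 := (hasDerivAt_iff_tendsto_slope_zero.1 (h.hasDerivAt i 0)).mono_left
      (nhdsWithin_mono (0 : ℝ) (fun t (ht : t ∈ Set.Ioi 0) => ht.ne'))
    filter_upwards [h1.eventually (lt_mem_nhds (half_lt_self hi)), self_mem_nhdsWithin] with t ht ht0
    rw [Set.mem_Ioi] at ht0
    simp only [zero_add, h.map_zero, sub_zero, smul_eq_mul] at ht
    rw [inv_mul_eq_div, lt_div_iff₀ ht0] at ht
    simpa using ht.le
  | succ j ih =>
    push_cast at hz hr ⊢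
    have hz' : ∀ l, i < l → l < i + 2 * j + 2 → e l 0 = 0 := fun l h1 h2 => hz l h1 (by linarith)
    obtain ⟨c, hc, hleft⟩ := ih h i hi (fun l h1 h2 => hz' l h1 (by linarith)) (by
      rcases Nat.eq_zero_or_pos j with h0 | h0
      · simpa [h0] using hi.le
      · exact (hz' _ (by omega) (by omega)).ge)
    obtain ⟨M', hmid⟩ := h.abs_le_pow (j + 1) (i + j + 1) (by
      intro l hl
      rw [abs_lt] at hl
      push_cast at hl
      exact hz' l (by omega) (by omega))
    have hright : ∃ M ≥ 0, ∀ᶠ t in 𝓝[>] (0 : ℝ), -(M * t ^ (j + 2)) ≤ G (i + j + 1 + 1) t := by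
      rcases hr.eq_or_lt with h0 | h0
      · obtain ⟨M, hM⟩ := h.abs_le_pow (j + 1) (i + j + 1 + 1) (by
          intro l hl
          rw [abs_lt] at hl
          push_cast at hl
          rcases lt_or_ge l (i + 2 * j + 2) with h1 | h1
          · exact hz' l (by omega) h1
          · rw [show l = i + 2 * ((j : ℤ) + 1) by omega]
            exact h0.symm)
        refine ⟨|M|, abs_nonneg M, ?_⟩
        filter_upwards [hM, self_mem_nhdsWithin] with t ht ht0
        rw [Set.mem_Ioi] at ht0
        have h1 : M * t ^ (j + 2) ≤ |M| * t ^ (j + 2) :=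
          mul_le_mul_of_nonneg_right (le_abs_self M) (by positivity)
        linarith [neg_abs_le (G (i + j + 1 + 1) t)]
      · obtain ⟨c', hc', h1⟩ := ih h.reflect (-(i + 2 * (j + 1))) (by rwa [neg_neg])
          (fun l h1 h2 => hz' (-l) (by omega) (by omega)) (by
            rcases Nat.eq_zero_or_pos j with h2 | h2
            · subst h2
              simpa using hr
            · exact (hz' _ (by omega) (by omega)).ge)
        refine ⟨0, le_rfl, ?_⟩
        filter_upwards [h1, self_mem_nhdsWithin] with t ht ht0
        rw [Set.mem_Ioi] at ht0
        rw [show -(-(i + 2 * ((j : ℤ) + 1)) + j) = i + j + 1 + 1 by ring] at ht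
        have : 0 < c' * t ^ (j + 1) := by positivity
        linarith
    obtain ⟨M, hM, hright⟩ := hright
    rw [← add_assoc]
    refine pow_le_of_deriv (h.map_zero _) (h.hasDerivAt _) ⟨C⁻¹ * c / 2, by positivity, ?_⟩
    have hsmall : ∀ᶠ t in 𝓝[>] (0 : ℝ), (C * M + C * |M'|) * t ≤ C⁻¹ * c / 2 := by
      have : Tendsto (fun t : ℝ => (C * M + C * |M'|) * t) (𝓝[>] 0) (𝓝 0) := by
        have h1 : Continuous fun t : ℝ => (C * M + C * |M'|) * t := by fun_prop
        simpa using (h1.tendsto 0).mono_left nhdsWithin_le_nhds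
      exact (this.eventually (gt_mem_nhds (by positivity : 0 < C⁻¹ * c / 2))).mono fun _ => le_of_lt
    filter_upwards [hleft, hright, hmid, hsmall, self_mem_nhdsWithin] with t h1 h2 h3 h4 ht0
    rw [Set.mem_Ioi] at ht0
    obtain ⟨B, B', A, hB, hB', hA, he⟩ := h.coupling (i + j + 1) t
    rw [hz' (i + j + 1) (by omega) (by omega), sub_zero, add_sub_cancel_right] at he
    have hCi : 0 < C⁻¹ := inv_pos.2 hC
    have b1 : C⁻¹ * (c * t ^ (j + 1)) ≤ B * G (i + j) t :=
      mul_le_mul hB.1 h1 (by positivity) (hCi.le.trans hB.1)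
    have b2 : -(C * (M * t ^ (j + 2))) ≤ B' * G (i + j + 1 + 1) t := by
      have h5 : B' * -(M * t ^ (j + 2)) ≤ B' * G (i + j + 1 + 1) t :=
        mul_le_mul_of_nonneg_left h2 (hCi.le.trans hB'.1)
      have h6 : B' * (M * t ^ (j + 2)) ≤ C * (M * t ^ (j + 2)) :=
        mul_le_mul_of_nonneg_right hB'.2 (by positivity)
      linarith
    have b3 : -(C * (|M'| * t ^ (j + 2))) ≤ A * G (i + j + 1) t := by
      have h5 : |A * G (i + j + 1) t| ≤ C * (|M'| * t ^ (j + 2)) := by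
        rw [abs_mul]
        refine mul_le_mul hA (h3.trans ?_) (abs_nonneg _) hC.le
        exact mul_le_mul_of_nonneg_right (le_abs_self M') (by positivity)
      linarith [neg_abs_le (A * G (i + j + 1) t)]
    have b4 : (C * M + C * |M'|) * t * t ^ (j + 1) ≤ C⁻¹ * c / 2 * t ^ (j + 1) :=
      mul_le_mul_of_nonneg_right h4 (by positivity)
    have b5 : t ^ (j + 2) = t * t ^ (j + 1) := by ring
    rw [b5] at b2 b3
    rw [he]
    linarith

/-- The sign of `e_i (0)` spreads to the right. -/
theorem IsPositivelyCoupled.sign_right (hC : 0 < C) (h : IsPositivelyCoupled C G e) (i : ℤ) (j : ℕ)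
    (hi : e i 0 ≠ 0) (hz : ∀ l, i < l → l < i + 2 * j → e l 0 = 0)
    (hr : 0 ≤ e i 0 * e (i + 2 * j) 0) :
    ∀ᶠ t in 𝓝[>] (0 : ℝ), SignType.sign (G (i + j) t) = SignType.sign (e i 0) := by
  rcases hi.lt_or_gt with hi | hi
  · obtain ⟨c, hc, h1⟩ := h.neg.pow_le hC j i (by simpa using hi)
      (fun l h1 h2 => by rw [hz l h1 h2, neg_zero]) (by
        have := nonpos_of_mul_nonneg_right hr hi
        linarith)
    filter_upwards [h1, self_mem_nhdsWithin] with t ht ht0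
    rw [Set.mem_Ioi] at ht0
    have : 0 < c * t ^ (j + 1) := by positivity
    rw [sign_neg hi, sign_neg (by linarith)]
  · obtain ⟨c, hc, h1⟩ := h.pow_le hC j i hi hz (nonneg_of_mul_nonneg_right hr hi)
    filter_upwards [h1, self_mem_nhdsWithin] with t ht ht0
    rw [Set.mem_Ioi] at ht0
    have : 0 < c * t ^ (j + 1) := by positivity
    rw [sign_pos hi, sign_pos (by linarith)]

/-- The sign of `e_i (0)` spreads to the left. -/
theorem IsPositivelyCoupled.sign_left (hC : 0 < C) (h : IsPositivelyCoupled C G e) (i : ℤ) (j : ℕ)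
    (hi : e i 0 ≠ 0) (hz : ∀ l, i - 2 * j < l → l < i → e l 0 = 0)
    (hr : 0 ≤ e i 0 * e (i - 2 * j) 0) :
    ∀ᶠ t in 𝓝[>] (0 : ℝ), SignType.sign (G (i - j) t) = SignType.sign (e i 0) := by
  have h1 := h.reflect.sign_right hC (-i) j (by rwa [neg_neg])
    (fun l h1 h2 => hz (-l) (by linarith) (by linarith)) (by
      rwa [neg_neg, show -(-i + 2 * (j : ℤ)) = i - 2 * j by ring])
  rwa [neg_neg, show -(-i + (j : ℤ)) = i - j by ring] at h1

/-- A nonzero `e_i (0)` gives `G_i (-t)` the opposite sign. -/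
theorem IsPositivelyCoupled.sign_neg_time (hC : 0 < C) (h : IsPositivelyCoupled C G e) (i : ℤ)
    (hi : e i 0 ≠ 0) :
    ∀ᶠ t in 𝓝[>] (0 : ℝ), SignType.sign (G i (-t)) = -SignType.sign (e i 0) := by
  have h1 := h.reverse.sign_right hC i 0 (by simpa [zpow_ne_zero] using hi)
    (fun l h1 h2 => by simp at h2; omega) (by simpa using mul_self_nonneg _)
  filter_upwards [h1] with t ht
  rw [Nat.cast_zero, add_zero, neg_zero, zpow_add_one₀ (by norm_num)] at ht
  rcases Int.even_or_odd i with hk | hk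
  · simp only [hk.neg_one_zpow, one_mul, neg_mul, Left.sign_neg] at ht
    rw [← ht, neg_neg]
  · simp only [hk.neg_one_zpow, one_mul, neg_mul, mul_neg, neg_neg, mul_one, Left.sign_neg] at ht
    exact ht

/-- Backwards in time, the sign of a neighbour of `i` at which `e (0)` vanishes is opposite to that
of `i`, unless the next coordinate forbids it. -/
theorem IsPositivelyCoupled.sign_neg_time_right (hC : 0 < C) (h : IsPositivelyCoupled C G e)
    (i : ℤ) (hi : e i 0 ≠ 0) (hz : e (i + 1) 0 = 0) (hr : 0 ≤ e i 0 * e (i + 2) 0) :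
    ∀ᶠ t in 𝓝[>] (0 : ℝ), SignType.sign (G (i + 1) (-t)) = SignType.sign (e i 0) := by
  have hsq : ((-1 : ℝ) ^ i) * (-1) ^ i = 1 := by
    rcases Int.even_or_odd i with hk | hk <;> simp [hk.neg_one_zpow]
  have h2 : ((-1 : ℝ)) ^ (i + 1 + 1) = (-1) ^ i := by
    rw [zpow_add_one₀ (by norm_num), zpow_add_one₀ (by norm_num)]
    ring
  have h1 := h.reverse.sign_right hC i 1 (by simpa [zpow_ne_zero] using hi)
    (fun l h1 h2 => by
      have : l = i + 1 := by push_cast at h2; omega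
      rw [this, neg_zero, hz, mul_zero]) (by
      rw [neg_zero, Nat.cast_one, mul_one, show i + 2 = i + 1 + 1 by ring, h2,
        show i + 1 + 1 = i + 2 by ring]
      linear_combination hr - e i 0 * e (i + 2) 0 * hsq)
  filter_upwards [h1] with t ht
  rw [Nat.cast_one, neg_zero, h2] at ht
  rcases Int.even_or_odd i with hk | hk
  · simpa only [hk.neg_one_zpow, one_mul] using ht
  · simp only [hk.neg_one_zpow, one_mul, neg_mul, Left.sign_neg] at ht
    exact neg_injective ht

theorem IsPositivelyCoupled.sign_neg_time_left (hC : 0 < C) (h : IsPositivelyCoupled C G e)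
    (i : ℤ) (hi : e i 0 ≠ 0) (hz : e (i - 1) 0 = 0) (hr : 0 ≤ e i 0 * e (i - 2) 0) :
    ∀ᶠ t in 𝓝[>] (0 : ℝ), SignType.sign (G (i - 1) (-t)) = SignType.sign (e i 0) := by
  have h1 := h.reflect.sign_neg_time_right hC (-i) (by rwa [neg_neg])
    (by rwa [show -(-i + 1) = i - 1 by ring])
    (by rwa [neg_neg, show -(-i + 2) = i - 2 by ring])
  rwa [neg_neg, show -(-i + 1) = i - 1 by ring] at h1

end

/-! ### Counting sign changes -/

/-- The relation between a sequence `s` with values in `{-1, 0, 1}` (the signs at time `0`) and the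
sequences `p`, `q` of the signs at a small positive, respectively negative, time: on the indices
`0, …, M`, the nonzero values of `s` spread into the blocks of zeros as far as the middle, forwards
in time, and change sign when they spread to the nearest neighbours, backwards in time. -/
structure IsSpreading (M : ℕ) (s p q : ℕ → ℝ) : Prop where
  values : ∀ i, s i = -1 ∨ s i = 0 ∨ s i = 1
  abs_le : ∀ i, |q i| ≤ 1
  right : ∀ i j, i + 2 * j ≤ M → s i ≠ 0 → (∀ l, i < l → l < i + 2 * j → s l = 0) →
    0 ≤ s i * s (i + 2 * j) → p (i + j) = s i
  left : ∀ i j, i + 2 * j ≤ M → s (i + 2 * j) ≠ 0 → (∀ l, i < l → l < i + 2 * j → s l = 0) →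
    0 ≤ s i * s (i + 2 * j) → p (i + j) = s (i + 2 * j)
  back : ∀ i, i ≤ M → s i ≠ 0 → q i = -s i
  back_right : ∀ i, i + 2 ≤ M → s i ≠ 0 → s (i + 1) = 0 → 0 ≤ s i * s (i + 2) → q (i + 1) = s i
  back_left : ∀ i, i + 2 ≤ M → s (i + 2) ≠ 0 → s (i + 1) = 0 → 0 ≤ s i * s (i + 2) →
    q (i + 1) = s (i + 2)

section

variable {M : ℕ} {s p q : ℕ → ℝ}

theorem IsSpreading.mul_self (h : IsSpreading M s p q) {i : ℕ} (hi : s i ≠ 0) : s i * s i = 1 := by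
  rcases h.values i with h | h | h
  · rw [h]; norm_num
  · exact absurd h hi
  · rw [h]; norm_num

theorem IsSpreading.eq_or_eq_neg (h : IsSpreading M s p q) {i l : ℕ} (hi : s i ≠ 0) (hl : s l ≠ 0) :
    s l = s i ∨ s l = -s i := by
  rcases h.values i with h1 | h1 | h1 <;> rcases h.values l with h2 | h2 | h2 <;>
    simp_all

/-- Between two consecutive nonzero values of `s`, with `n ≥ 1` zeros in between, the sum of the
products of neighbours is at most `n - 3` backwards in time, except if `n = 1` and the two values are
opposite: there is a sign change at both ends of the block. -/
theorem IsSpreading.sum_back_le (h : IsSpreading M s p q) {i n : ℕ} (hn : 1 ≤ n)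
    (hM : i + n + 1 ≤ M) (hi : s i ≠ 0) (hl : s (i + n + 1) ≠ 0)
    (hz : ∀ k, i < k → k < i + n + 1 → s k = 0) (hs : 2 ≤ n ∨ s (i + n + 1) = s i) :
    ∑ k ∈ Finset.range (n + 1), q (i + k) * q (i + k + 1) ≤ (n : ℝ) - 3 := by
  have hle : ∀ u v : ℕ, q u * q v ≤ 1 := by
    intro u v
    have h1 : |q u * q v| ≤ 1 * 1 := by
      rw [abs_mul]
      exact mul_le_mul (h.abs_le u) (h.abs_le v) (abs_nonneg _) zero_le_one
    linarith [le_abs_self (q u * q v)]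
  have hii := h.mul_self hi
  have hll := h.mul_self hl
  have hend : 0 ≤ s i * s (i + 2) := by
    rcases hs with hs | hs
    · rw [hz (i + 2) (by omega) (by omega), mul_zero]
    · rcases eq_or_lt_of_le hn with hn | hn
      · rw [← hn] at hs
        rw [show i + 2 = i + 1 + 1 by ring, hs]
        exact mul_self_nonneg _
      · rw [hz (i + 2) (by omega) (by omega), mul_zero]
  have hend' : 0 ≤ s (i + n - 1) * s (i + n - 1 + 2) := by
    rcases eq_or_lt_of_le hn with hn | hn
    · rw [← hn, Nat.add_sub_cancel]
      exact hend
    · rw [hz (i + n - 1) (by omega) (by omega), zero_mul]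
  have hfirst : q i * q (i + 1) = -1 := by
    rw [h.back i (by omega) hi, h.back_right i (by omega) hi (hz _ (by omega) (by omega)) hend]
    linarith
  have hlast : q (i + n) * q (i + n + 1) = -1 := by
    have h1 := h.back_left (i + n - 1) (by omega)
      (by rwa [show i + n - 1 + 2 = i + n + 1 by omega]) (hz _ (by omega) (by omega)) hend'
    rw [show i + n - 1 + 1 = i + n by omega, show i + n - 1 + 2 = i + n + 1 by omega] at h1
    rw [h1, h.back _ hM hl]
    linarith
  have hterm : ∀ k ∈ Finset.range (n + 1), q (i + k) * q (i + k + 1) ≤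
      1 - (if k = 0 then 2 else 0) - (if k = n then 2 else 0) := by
    intro k _
    by_cases h0 : k = 0
    · subst h0
      rw [if_pos rfl, if_neg (by omega), add_zero, hfirst]
      norm_num
    · by_cases h1 : k = n
      · subst h1
        rw [if_neg h0, if_pos rfl, hlast]
        norm_num
      · rw [if_neg h0, if_neg h1]
        simpa using hle (i + k) (i + k + 1)
  refine (Finset.sum_le_sum hterm).trans (le_of_eq ?_)
  simp only [Finset.sum_sub_distrib, Finset.sum_const, Finset.card_range, nsmul_eq_mul, mul_one,
    Finset.sum_ite_eq', Finset.mem_range, Nat.zero_lt_succ, if_true, Nat.lt_succ_self]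
  push_cast
  ring

/-- If the two ends of a block of zeros have the same sign, this sign fills the block. -/
theorem IsSpreading.sum_eq_of_eq (h : IsSpreading M s p q) {i n : ℕ} (hM : i + n + 1 ≤ M)
    (hi : s i ≠ 0) (hz : ∀ k, i < k → k < i + n + 1 → s k = 0) (hs : s (i + n + 1) = s i) :
    ∑ k ∈ Finset.range (n + 1), p (i + k) * p (i + k + 1) = (n : ℝ) + 1 := by
  have hl : s (i + n + 1) ≠ 0 := by rwa [hs]
  have hpos : ∀ k, i ≤ k → k ≤ i + n + 1 → 0 ≤ s i * s k := by
    intro k h1 h2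
    rcases eq_or_lt_of_le h1 with h1 | h1
    · rw [← h1]; exact mul_self_nonneg _
    · rcases eq_or_lt_of_le h2 with h2 | h2
      · rw [h2, hs]; exact mul_self_nonneg _
      · rw [hz k h1 h2, mul_zero]
  have hall : ∀ k, k ≤ n + 1 → p (i + k) = s i := by
    intro k hk
    rcases le_total (2 * k) (n + 1) with h2 | h2
    · exact h.right i k (by omega) hi (fun l h3 h4 => hz l h3 (by omega))
        (hpos _ (by omega) (by omega))
    · have h1 := h.left (i + (2 * k - (n + 1))) (n + 1 - k) (by omega)
        (by rwa [show i + (2 * k - (n + 1)) + 2 * (n + 1 - k) = i + n + 1 by omega])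
        (fun l h3 h4 => hz l (by omega) (by omega)) (by
          rw [show i + (2 * k - (n + 1)) + 2 * (n + 1 - k) = i + n + 1 by omega, hs, mul_comm]
          exact hpos _ (by omega) (by omega))
      rw [show i + (2 * k - (n + 1)) + 2 * (n + 1 - k) = i + n + 1 by omega, hs,
        show i + (2 * k - (n + 1)) + (n + 1 - k) = i + k by omega] at h1
      exact h1
  have hterm : ∀ k ∈ Finset.range (n + 1), p (i + k) * p (i + k + 1) = 1 := by
    intro k hk
    rw [Finset.mem_range] at hk
    rw [hall k (by omega), add_assoc, hall (k + 1) (by omega), h.mul_self hi]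
  rw [Finset.sum_congr rfl hterm]
  simp

/-- If the two ends of a block of zeros have opposite signs, each of them fills its half of the
block, and there is one sign change. A middle index equally far from both ends may have any sign. -/
theorem IsSpreading.sum_eq_of_eq_neg (h : IsSpreading M s p q) {i n : ℕ} (hM : i + n + 1 ≤ M)
    (hi : s i ≠ 0) (hz : ∀ k, i < k → k < i + n + 1 → s k = 0) (hs : s (i + n + 1) = -s i) :
    ∑ k ∈ Finset.range (n + 1), p (i + k) * p (i + k + 1) = (n : ℝ) - 1 := by
  have hl : s (i + n + 1) ≠ 0 := by rwa [hs, neg_ne_zero]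
  have hii := h.mul_self hi
  have hlow : ∀ k, 2 * k ≤ n → p (i + k) = s i := by
    intro k hk
    refine h.right i k (by omega) hi (fun l h3 h4 => hz l h3 (by omega)) ?_
    rcases Nat.eq_zero_or_pos k with h0 | h0
    · rw [h0]; exact mul_self_nonneg _
    · rw [hz (i + 2 * k) (by omega) (by omega), mul_zero]
  have hhigh : ∀ k, k ≤ n + 1 → n + 2 ≤ 2 * k → p (i + k) = -s i := by
    intro k hk h2
    have h1 := h.left (i + (2 * k - (n + 1))) (n + 1 - k) (by omega)
      (by rwa [show i + (2 * k - (n + 1)) + 2 * (n + 1 - k) = i + n + 1 by omega])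
      (fun l h3 h4 => hz l (by omega) (by omega)) (by
        rcases eq_or_lt_of_le hk with h0 | h0
        · rw [h0, Nat.sub_self, Nat.mul_zero, add_zero]
          exact mul_self_nonneg _
        · rw [hz (i + (2 * k - (n + 1))) (by omega) (by omega), zero_mul])
    rwa [show i + (2 * k - (n + 1)) + 2 * (n + 1 - k) = i + n + 1 by omega, hs,
      show i + (2 * k - (n + 1)) + (n + 1 - k) = i + k by omega] at h1
  rcases Nat.even_or_odd' n with ⟨d, hd | hd⟩
  · have hterm : ∀ k ∈ Finset.range (n + 1), p (i + k) * p (i + k + 1) =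
        1 - (if k = d then 2 else 0) := by
      intro k hk
      rw [Finset.mem_range] at hk
      rw [add_assoc i k 1]
      rcases lt_trichotomy k d with h1 | h1 | h1
      · rw [if_neg h1.ne, hlow k (by omega), hlow (k + 1) (by omega)]
        linarith
      · rw [if_pos h1, hlow k (by omega), hhigh (k + 1) (by omega) (by omega)]
        linarith
      · rw [if_neg h1.ne', hhigh k (by omega) (by omega), hhigh (k + 1) (by omega) (by omega)]
        linarith
    rw [Finset.sum_congr rfl hterm]
    have : d < n + 1 := by omega
    simp only [Finset.sum_sub_distrib, Finset.sum_const, Finset.card_range, nsmul_eq_mul, mul_one,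
      Finset.sum_ite_eq', Finset.mem_range, this, if_true]
    push_cast
    ring
  · have hterm : ∀ k ∈ Finset.range (n + 1), p (i + k) * p (i + k + 1) =
        1 - (if k = d then 1 - s i * p (i + d + 1) else 0) -
          (if k = d + 1 then 1 + s i * p (i + d + 1) else 0) := by
      intro k hk
      rw [Finset.mem_range] at hk
      rw [add_assoc i k 1]
      rcases lt_trichotomy k d with h1 | h1 | h1
      · rw [if_neg h1.ne, if_neg (by omega), hlow k (by omega), hlow (k + 1) (by omega)]
        linarith
      · rw [if_pos h1, if_neg (by omega), hlow k (by omega), h1, add_assoc]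
        ring
      · rw [if_neg h1.ne']
        rcases eq_or_lt_of_le (Nat.succ_le_of_lt h1) with h2 | h2
        · rw [if_pos h2.symm, hhigh (k + 1) (by omega) (by omega), ← h2, Nat.succ_eq_add_one,
            add_assoc]
          ring
        · rw [if_neg (by omega), hhigh k (by omega) (by omega),
            hhigh (k + 1) (by omega) (by omega)]
          linarith
    rw [Finset.sum_congr rfl hterm]
    have h1 : d < n + 1 := by omega
    have h2 : d + 1 < n + 1 := by omega
    simp only [Finset.sum_sub_distrib, Finset.sum_const, Finset.card_range, nsmul_eq_mul, mul_one,
      Finset.sum_ite_eq', Finset.mem_range, h1, h2, if_true]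
    push_cast
    ring

/-- The comparison of the two times on one block of zeros. -/
theorem IsSpreading.block (h : IsSpreading M s p q) {i n : ℕ} (hM : i + n + 1 ≤ M) (hi : s i ≠ 0)
    (hl : s (i + n + 1) ≠ 0) (hz : ∀ k, i < k → k < i + n + 1 → s k = 0) :
    ∑ k ∈ Finset.range (n + 1), q (i + k) * q (i + k + 1) ≤
        ∑ k ∈ Finset.range (n + 1), p (i + k) * p (i + k + 1) ∧
      (∑ k ∈ Finset.range (n + 1), p (i + k) * p (i + k + 1) ≤
          ∑ k ∈ Finset.range (n + 1), q (i + k) * q (i + k + 1) →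
        ∀ k, k < n → s (i + k) * s (i + k + 2) < 0) := by
  rcases Nat.eq_zero_or_pos n with hn | hn
  · subst hn
    refine ⟨?_, fun _ k hk => absurd hk (Nat.not_lt_zero k)⟩
    have h1 := h.right i 0 (by omega) hi (fun l h1 h2 => by omega) (mul_self_nonneg _)
    have h2 := h.right (i + 1) 0 (by omega) hl (fun l h1 h2 => by omega) (mul_self_nonneg _)
    simp only [zero_add, Finset.sum_range_one, add_zero] at h1 h2 ⊢
    rw [h1, h2, h.back i (by omega) hi, h.back (i + 1) (by omega) hl, neg_mul_neg]
  · rcases h.eq_or_eq_neg hi hl with hs | hs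
    · have h1 := h.sum_eq_of_eq hM hi hz hs
      have h2 := h.sum_back_le hn hM hi hl hz (Or.inr hs)
      rw [h1]
      exact ⟨by linarith, fun h3 => by linarith⟩
    · have h1 := h.sum_eq_of_eq_neg hM hi hz hs
      rcases eq_or_lt_of_le (Nat.succ_le_of_lt hn) with hn1 | hn1
      · have hn1 : n = 1 := hn1.symm
        subst hn1
        rw [h1]
        constructor
        · have h2 := h.back i (by omega) hi
          have h3 := h.back (i + 1 + 1) (by omega) hl
          simp only [Finset.sum_range_succ, Finset.sum_range_zero, zero_add, add_zero]
          rw [h2, h3, hs, Nat.cast_one]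
          linarith
        · intro _ k hk
          have hk : k = 0 := by omega
          rw [hk, add_zero, show i + 2 = i + 1 + 1 by ring, hs]
          have := h.mul_self hi
          linarith
      · have h2 := h.sum_back_le hn hM hi hl hz (Or.inl hn1)
        rw [h1]
        exact ⟨by linarith, fun h3 => by linarith⟩

/-- The number of sign changes does not increase, and it is constant only if all the zeros of `s`
are isolated and lie between opposite values. -/
theorem IsSpreading.sum_le (h : IsSpreading M s p q) (d i : ℕ) (hM : i + d ≤ M) (hi : s i ≠ 0)
    (hd : s (i + d) ≠ 0) :
    ∑ k ∈ Finset.range d, q (i + k) * q (i + k + 1) ≤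
        ∑ k ∈ Finset.range d, p (i + k) * p (i + k + 1) ∧
      (∑ k ∈ Finset.range d, p (i + k) * p (i + k + 1) ≤
          ∑ k ∈ Finset.range d, q (i + k) * q (i + k + 1) →
        ∀ k, k + 1 < d → s (i + k + 1) = 0 → s (i + k) * s (i + k + 2) < 0) := by
  induction d using Nat.strong_induction_on generalizing i with
  | _ d ih =>
    rcases Nat.eq_zero_or_pos d with h0 | h0
    · subst h0
      exact ⟨by simp, fun _ k hk => by omega⟩
    · have hex : ∃ n, s (i + n + 1) ≠ 0 := ⟨d - 1, by rwa [show i + (d - 1) + 1 = i + d by omega]⟩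
      classical
      obtain ⟨n, hn, hmin⟩ : ∃ n, s (i + n + 1) ≠ 0 ∧ ∀ k < n, s (i + k + 1) = 0 :=
        ⟨Nat.find hex, Nat.find_spec hex, fun k hk => not_not.1 (Nat.find_min hex hk)⟩
      have hnd : n + 1 ≤ d := by
        by_contra hlt
        have := hmin (d - 1) (by omega)
        rw [show i + (d - 1) + 1 = i + d by omega] at this
        exact hd this
      obtain ⟨d', rfl⟩ : ∃ d', d = n + 1 + d' := ⟨d - (n + 1), by omega⟩
      have hz : ∀ k, i < k → k < i + n + 1 → s k = 0 := by
        intro k h1 h2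
        have := hmin (k - i - 1) (by omega)
        rwa [show i + (k - i - 1) + 1 = k by omega] at this
      obtain ⟨b1, b2⟩ := h.block (by omega) hi hn hz
      obtain ⟨c1, c2⟩ := ih d' (by omega) (i + n + 1) (by omega) hn
        (by rwa [show i + n + 1 + d' = i + (n + 1 + d') by ring])
      have hsplit : ∀ r : ℕ → ℝ, ∑ k ∈ Finset.range (n + 1 + d'), r (i + k) * r (i + k + 1) =
          ∑ k ∈ Finset.range (n + 1), r (i + k) * r (i + k + 1) +
          ∑ k ∈ Finset.range d', r (i + n + 1 + k) * r (i + n + 1 + k + 1) := by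
        intro r
        rw [Finset.sum_range_add]
        congr 1
        refine Finset.sum_congr rfl fun k _ => ?_
        rw [show i + (n + 1 + k) = i + n + 1 + k by ring]
      rw [hsplit, hsplit]
      refine ⟨add_le_add b1 c1, fun hle k hk hk0 => ?_⟩
      rcases lt_trichotomy k n with h1 | h1 | h1
      · exact b2 (by linarith) k h1
      · exact absurd hk0 (by rwa [h1])
      · have := c2 (by linarith) (k - (n + 1)) (by omega)
          (by rwa [show i + n + 1 + (k - (n + 1)) + 1 = i + k + 1 by omega])
        rwa [show i + n + 1 + (k - (n + 1)) = i + k by omega] at this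

end

section

variable {C : ℝ} {G e : ℤ → ℝ → ℝ}

theorem sum_range_eq_of_periodic {h : ℤ → ℝ} {M : ℕ} (hp : ∀ k, h (k + M) = h k) (i : ℤ) :
    ∑ k ∈ Finset.range M, h (i + k) = ∑ k ∈ Finset.range M, h k := by
  have hstep : ∀ i : ℤ, ∑ k ∈ Finset.range M, h (i + 1 + k) = ∑ k ∈ Finset.range M, h (i + k) := by
    intro i
    have h1 := Finset.sum_range_sub (fun k : ℕ => h (i + k)) M
    rw [hp i, Nat.cast_zero, add_zero, sub_self, Finset.sum_sub_distrib, sub_eq_zero] at h1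
    rw [← h1]
    refine Finset.sum_congr rfl fun k _ => ?_
    congr 1
    push_cast
    ring
  induction i using Int.induction_on with
  | zero => simp
  | succ i ih => rw [hstep, ih]
  | pred i ih =>
    rw [← ih, ← hstep (-(i : ℤ) - 1), sub_add_cancel]

/-- If the number of sign changes of `G (t)` is the same for small positive and for small negative
`t`, then the zeros of `e (0)` are isolated and lie between opposite values. -/
theorem IsPositivelyCoupled.mul_neg (hC : 0 < C) (h : IsPositivelyCoupled C G e) {M : ℕ}
    (hM : 0 < M) {ε : ℝ} (hε : ε * ε = 1) (hG : ∀ k t, G (k + M) t = ε * G k t)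
    (he : ∀ k, e (k + M) 0 = ε * e k 0) (hne : ∃ k, e k 0 ≠ 0)
    (hsum : ∀ᶠ t in 𝓝[>] (0 : ℝ),
      ∑ k ∈ Finset.range M, (SignType.sign (G k t) : ℝ) * (SignType.sign (G (k + 1) t) : ℝ) =
      ∑ k ∈ Finset.range M, (SignType.sign (G k (-t)) : ℝ) * (SignType.sign (G (k + 1) (-t)) : ℝ))
    (k : ℤ) (hk : e k 0 = 0) : e (k - 1) 0 * e (k + 1) 0 < 0 := by
  have hMz : (0 : ℤ) < M := by exact_mod_cast hM
  -- a period `i, …, i + M` that contains `k` in its interior and begins with a nonzero value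
  obtain ⟨i, hi, hik, hki⟩ : ∃ i, e i 0 ≠ 0 ∧ i < k ∧ k < i + M := by
    obtain ⟨i₀, hi₀⟩ := hne
    have hper : Function.Periodic (fun k => e k 0 * e k 0) (M : ℤ) := by
      intro k
      change e (k + M) 0 * e (k + M) 0 = e k 0 * e k 0
      rw [he]
      linear_combination e k 0 * e k 0 * hε
    have hi : e (i₀ + (k - i₀) / M * M) 0 ≠ 0 := by
      have h1 := hper.int_mul ((k - i₀) / M) i₀
      change e (i₀ + (k - i₀) / M * M) 0 * e (i₀ + (k - i₀) / M * M) 0 = e i₀ 0 * e i₀ 0 at h1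
      intro h2
      rw [h2, mul_zero] at h1
      exact hi₀ (mul_self_eq_zero.1 h1.symm)
    have h1 := Int.emod_nonneg (k - i₀) hMz.ne'
    have h2 := Int.emod_lt_of_pos (k - i₀) hMz
    have h3 := Int.emod_add_ediv_mul (k - i₀) M
    refine ⟨_, hi, lt_of_le_of_ne (by linarith) ?_, by linarith⟩
    rintro h4
    rw [h4] at hi
    exact hi hk
  have hiM : e (i + M) 0 ≠ 0 := by
    rw [he]
    refine mul_ne_zero ?_ hi
    rintro rfl
    simp at hε
  have hR : ∀ᶠ t in 𝓝[>] (0 : ℝ), ∀ u ∈ Finset.range (M + 1), ∀ j ∈ Finset.range (M + 1),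
      (e (i + u) 0 ≠ 0 ∧ (∀ l, i + u < l → l < i + u + 2 * j → e l 0 = 0) ∧
        0 ≤ e (i + u) 0 * e (i + u + 2 * j) 0) →
      SignType.sign (G (i + u + j) t) = SignType.sign (e (i + u) 0) :=
    (Filter.eventually_all_finset _).2 fun u _ => (Filter.eventually_all_finset _).2 fun j _ =>
      Filter.eventually_imp_distrib_left.2 fun h1 => h.sign_right hC _ j h1.1 h1.2.1 h1.2.2
  have hL : ∀ᶠ t in 𝓝[>] (0 : ℝ), ∀ u ∈ Finset.range (M + 1), ∀ j ∈ Finset.range (M + 1),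
      (e (i + u) 0 ≠ 0 ∧ (∀ l, i + u - 2 * j < l → l < i + u → e l 0 = 0) ∧
        0 ≤ e (i + u) 0 * e (i + u - 2 * j) 0) →
      SignType.sign (G (i + u - j) t) = SignType.sign (e (i + u) 0) :=
    (Filter.eventually_all_finset _).2 fun u _ => (Filter.eventually_all_finset _).2 fun j _ =>
      Filter.eventually_imp_distrib_left.2 fun h1 => h.sign_left hC _ j h1.1 h1.2.1 h1.2.2
  have hB : ∀ᶠ t in 𝓝[>] (0 : ℝ), ∀ u ∈ Finset.range (M + 1), e (i + u) 0 ≠ 0 →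
      SignType.sign (G (i + u) (-t)) = -SignType.sign (e (i + u) 0) :=
    (Filter.eventually_all_finset _).2 fun u _ =>
      Filter.eventually_imp_distrib_left.2 fun h1 => h.sign_neg_time hC _ h1
  have hBR : ∀ᶠ t in 𝓝[>] (0 : ℝ), ∀ u ∈ Finset.range (M + 1),
      (e (i + u) 0 ≠ 0 ∧ e (i + u + 1) 0 = 0 ∧ 0 ≤ e (i + u) 0 * e (i + u + 2) 0) →
      SignType.sign (G (i + u + 1) (-t)) = SignType.sign (e (i + u) 0) :=
    (Filter.eventually_all_finset _).2 fun u _ => Filter.eventually_imp_distrib_left.2 fun h1 =>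
      h.sign_neg_time_right hC _ h1.1 h1.2.1 h1.2.2
  have hBL : ∀ᶠ t in 𝓝[>] (0 : ℝ), ∀ u ∈ Finset.range (M + 1),
      (e (i + u) 0 ≠ 0 ∧ e (i + u - 1) 0 = 0 ∧ 0 ≤ e (i + u) 0 * e (i + u - 2) 0) →
      SignType.sign (G (i + u - 1) (-t)) = SignType.sign (e (i + u) 0) :=
    (Filter.eventually_all_finset _).2 fun u _ => Filter.eventually_imp_distrib_left.2 fun h1 =>
      h.sign_neg_time_left hC _ h1.1 h1.2.1 h1.2.2
  obtain ⟨t, hR, hL, hB, hBR, hBL, hsum⟩ :=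
    (hR.and (hL.and (hB.and (hBR.and (hBL.and hsum))))).exists
  have hval : ∀ u v : ℝ, 0 ≤ (SignType.sign u : ℝ) * (SignType.sign v : ℝ) → 0 ≤ u * v := by
    intro u v huv
    rw [← SignType.coe_mul, ← sign_mul] at huv
    by_contra hneg
    rw [not_le] at hneg
    rw [sign_neg hneg] at huv
    norm_num at huv
  have hs0 : ∀ u : ℝ, (SignType.sign u : ℝ) ≠ 0 ↔ u ≠ 0 := by
    intro u
    rcases lt_trichotomy u 0 with h1 | h1 | h1
    · simp [sign_neg h1, h1.ne]
    · simp [h1]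
    · simp [sign_pos h1, h1.ne']
  have hs0' : ∀ u : ℝ, (SignType.sign u : ℝ) = 0 ↔ u = 0 := fun u => not_iff_not.1 (hs0 u)
  have hspread : IsSpreading M (fun u => (SignType.sign (e (i + u) 0) : ℝ))
      (fun u => (SignType.sign (G (i + u) t) : ℝ))
      (fun u => (SignType.sign (G (i + u) (-t)) : ℝ)) := by
    refine ⟨?_, ?_, ?_, ?_, ?_, ?_, ?_⟩
    · intro u
      generalize SignType.sign (e (i + u) 0) = x
      cases x <;> simp
    · intro u
      generalize SignType.sign (G (i + u) (-t)) = x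
      cases x <;> simp
    · intro u j hM hu hz hp
      have h1 := hR u (by simp; omega) j (by simp; omega) ⟨(hs0 _).1 hu, ?_, ?_⟩
      · rw [← h1]
        push_cast
        rw [add_assoc]
      · intro l h1 h2
        have := (hs0' _).1 (hz (l - i).toNat (by omega) (by omega))
        rwa [show i + (((l - i).toNat : ℕ) : ℤ) = l by omega] at this
      · have := hval _ _ hp
        push_cast at this
        rwa [← add_assoc] at this
    · intro u j hM hu hz hp
      have h1 := hL (u + 2 * j) (by simp; omega) j (by simp; omega) ⟨(hs0 _).1 hu, ?_, ?_⟩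
      · rw [← h1]
        congr 3
        push_cast
        ring
      · intro l h1 h2
        push_cast at h1 h2
        have := (hs0' _).1 (hz (l - i).toNat (by omega) (by omega))
        rwa [show i + (((l - i).toNat : ℕ) : ℤ) = l by omega] at this
      · have := hval _ _ hp
        rw [show i + ((u + 2 * j : ℕ) : ℤ) - 2 * j = i + u by push_cast; ring, mul_comm]
        exact this
    · intro u hu h1
      rw [hB u (by simp; omega) ((hs0 _).1 h1), SignType.coe_neg]
    · intro u hu h1 h2 h3
      have h4 := (hs0' _).1 h2
      have h5 := hval _ _ h3
      push_cast at h4 h5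
      have h6 := hBR u (by simp; omega) ⟨(hs0 _).1 h1, by rwa [add_assoc], by rwa [add_assoc]⟩
      rw [← h6]
      push_cast
      rw [add_assoc]
    · intro u hu h1 h2 h3
      have h4 := (hs0' _).1 h2
      have h5 := hval _ _ h3
      have h6 := hBL (u + 2) (by simp; omega) ⟨(hs0 _).1 h1, by
        rwa [show i + ((u + 2 : ℕ) : ℤ) - 1 = i + ((u + 1 : ℕ) : ℤ) by push_cast; ring], by
        rwa [show i + ((u + 2 : ℕ) : ℤ) - 2 = i + u by push_cast; ring, mul_comm]⟩
      rw [← h6]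
      congr 3
      push_cast
      ring
  have hεG : ∀ t k, (SignType.sign (G (k + M) t) : ℝ) * (SignType.sign (G (k + 1 + M) t) : ℝ) =
      (SignType.sign (G k t) : ℝ) * (SignType.sign (G (k + 1) t) : ℝ) := by
    intro t k
    rw [← SignType.coe_mul, ← sign_mul, ← SignType.coe_mul, ← sign_mul, hG, hG]
    congr 2
    linear_combination G k t * G (k + 1) t * hε
  have hshift : ∀ t, ∑ k ∈ Finset.range M, (SignType.sign (G (i + k) t) : ℝ) *
      (SignType.sign (G (i + k + 1) t) : ℝ) =
      ∑ k ∈ Finset.range M, (SignType.sign (G k t) : ℝ) * (SignType.sign (G (k + 1) t) : ℝ) :=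
    fun t => sum_range_eq_of_periodic (h := fun k => (SignType.sign (G k t) : ℝ) *
      (SignType.sign (G (k + 1) t) : ℝ)) (fun k => by
        rw [show k + (M : ℤ) + 1 = k + 1 + M by ring]
        exact hεG t k) i
  have hmain := (hspread.sum_le M 0 (by omega) (by simpa [hs0] using hi)
    (by rw [zero_add]; exact (hs0 _).2 hiM)).2
  simp only [zero_add, Nat.cast_add, Nat.cast_one, ← add_assoc] at hmain
  rw [hshift, hshift] at hmain
  have hfin := hmain hsum.le (k - i - 1).toNat (by omega) (by
    rw [show i + (((k - i - 1).toNat : ℕ) : ℤ) + 1 = k by omega, hk]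
    simp)
  rw [show i + (((k - i - 1).toNat : ℕ) : ℤ) = k - 1 by omega, Nat.cast_ofNat,
    show k - 1 + 2 = k + 1 by ring] at hfin
  by_contra hneg
  rw [not_lt] at hneg
  have : (0 : ℝ) ≤ (SignType.sign (e (k - 1) 0) : ℝ) * (SignType.sign (e (k + 1) 0) : ℝ) := by
    rw [← SignType.coe_mul, ← sign_mul]
    rcases hneg.eq_or_lt with h1 | h1
    · rw [← h1]
      simp
    · rw [sign_pos h1]
      simp
  linarith

end

/-! ### Complete orbits of Lipschitz vector fields -/

section

variable {X : Type*} [NormedAddCommGroup X] [NormedSpace ℝ X]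

theorem norm_integral_le_exp_of_nonneg {w : ℝ → X} {D l : ℝ} (hl : 0 < l)
    (h : ∀ s, ‖w s‖ ≤ D * Real.exp (l * |s|)) {t : ℝ} (ht : 0 ≤ t) :
    ‖∫ s in (0 : ℝ)..t, w s‖ ≤ D / l * Real.exp (l * |t|) := by
  have hD : 0 ≤ D := by
    have := (norm_nonneg _).trans (h 0)
    simpa using this
  have h1 : ‖∫ s in (0 : ℝ)..t, w s‖ ≤ ∫ s in (0 : ℝ)..t, D * Real.exp (l * s) := by
    refine intervalIntegral.norm_integral_le_of_norm_le ht ?_ ?_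
    · filter_upwards with s hs
      have := h s
      rwa [abs_of_pos hs.1] at this
    · exact (by fun_prop : Continuous fun s : ℝ => D * Real.exp (l * s)).intervalIntegrable _ _
  have h2 : ∫ s in (0 : ℝ)..t, D * Real.exp (l * s) = D / l * Real.exp (l * t) - D / l := by
    have hd : ∀ s ∈ Set.uIcc 0 t, HasDerivAt (fun s => D / l * Real.exp (l * s))
        (D * Real.exp (l * s)) s := by
      intro s _
      have h3 := ((hasDerivAt_id s).const_mul l).exp.const_mul (D / l)
      refine h3.congr_deriv ?_
      simp only [id]
      field_simp
    rw [intervalIntegral.integral_eq_sub_of_hasDerivAt hd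
      ((by fun_prop : Continuous fun s : ℝ => D * Real.exp (l * s)).intervalIntegrable _ _)]
    simp
  rw [abs_of_nonneg ht]
  have : 0 ≤ D / l := by positivity
  linarith

theorem norm_integral_le_exp {w : ℝ → X} {D l : ℝ} (hl : 0 < l)
    (h : ∀ s, ‖w s‖ ≤ D * Real.exp (l * |s|)) (t : ℝ) :
    ‖∫ s in (0 : ℝ)..t, w s‖ ≤ D / l * Real.exp (l * |t|) := by
  rcases le_total 0 t with ht | ht
  · exact norm_integral_le_exp_of_nonneg hl h ht
  · have h1 := norm_integral_le_exp_of_nonneg (w := fun s => w (-s)) hl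
      (fun s => by simpa using h (-s)) (t := -t) (by linarith)
    rw [intervalIntegral.integral_comp_neg, neg_neg, neg_zero, intervalIntegral.integral_symm,
      norm_neg, abs_neg] at h1
    exact h1

/-- A Lipschitz vector field on a Banach space is complete: the Picard operator is a contraction for
the norm `sup_t exp (-l |t|) ‖γ t - x₀‖` when `l` is large. -/
theorem exists_orbit_of_lipschitz [CompleteSpace X] {v : X → X} {K : ℝ≥0} (hv : LipschitzWith K v)
    (x₀ : X) : ∃ γ : ℝ → X, γ 0 = x₀ ∧ ∀ t, HasDerivAt γ (v (γ t)) t := by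
  obtain ⟨l, hl⟩ : ∃ l : ℝ, l = 2 * K + 2 := ⟨_, rfl⟩
  have hK : (0 : ℝ) ≤ K := K.2
  have hl0 : 0 < l := by linarith
  let curve : BoundedContinuousFunction ℝ X → ℝ → X := fun φ s => x₀ + Real.exp (l * |s|) • φ s
  have hcurve : ∀ φ, Continuous (curve φ) := by
    intro φ
    have := φ.continuous
    fun_prop
  have hvc : ∀ φ, Continuous fun s => v (curve φ s) := fun φ => hv.continuous.comp (hcurve φ)
  have hnorm : ∀ φ s, ‖v (curve φ s)‖ ≤ (‖v x₀‖ + K * ‖φ‖) * Real.exp (l * |s|) := by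
    intro φ s
    have h1 : ‖v (curve φ s) - v x₀‖ ≤ K * (Real.exp (l * |s|) * ‖φ‖) := by
      refine (hv.norm_sub_le _ _).trans ?_
      simp only [curve, add_sub_cancel_left, norm_smul, Real.norm_eq_abs, Real.abs_exp]
      have := φ.norm_coe_le_norm s
      gcongr
    have h2 : ‖v (curve φ s)‖ ≤ ‖v (curve φ s) - v x₀‖ + ‖v x₀‖ := by
      simpa using norm_add_le (v (curve φ s) - v x₀) (v x₀)
    have h3 : (1 : ℝ) ≤ Real.exp (l * |s|) := Real.one_le_exp (by positivity)
    nlinarith [norm_nonneg (v x₀)]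
  have hexp : ∀ t (x : X), ‖Real.exp (-(l * |t|)) • x‖ = Real.exp (-(l * |t|)) * ‖x‖ := by
    intro t x
    rw [norm_smul, Real.norm_eq_abs, Real.abs_exp]
  have hcancel : ∀ t D : ℝ, Real.exp (-(l * |t|)) * (D * Real.exp (l * |t|)) = D := by
    intro t D
    rw [mul_left_comm, ← Real.exp_add, neg_add_cancel, Real.exp_zero, mul_one]
  let T : BoundedContinuousFunction ℝ X → BoundedContinuousFunction ℝ X := fun φ =>
    BoundedContinuousFunction.ofNormedAddCommGroup
      (fun t => Real.exp (-(l * |t|)) • ∫ s in (0 : ℝ)..t, v (curve φ s))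
      (by
        have h1 : Continuous fun t => ∫ s in (0 : ℝ)..t, v (curve φ s) :=
          intervalIntegral.continuous_primitive (fun a b => (hvc φ).intervalIntegrable a b) 0
        fun_prop)
      ((‖v x₀‖ + K * ‖φ‖) / l) (by
        intro t
        rw [hexp]
        refine (mul_le_mul_of_nonneg_left (norm_integral_le_exp hl0 (hnorm φ) t)
          (Real.exp_pos _).le).trans (le_of_eq (hcancel _ _)))
  have hT : ContractingWith (1 / 2) T := by
    refine ⟨by norm_num, LipschitzWith.of_dist_le_mul fun φ ψ => ?_⟩
    rw [BoundedContinuousFunction.dist_le (by positivity)]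
    intro t
    have h1 : ∀ s, ‖v (curve φ s) - v (curve ψ s)‖ ≤ K * dist φ ψ * Real.exp (l * |s|) := by
      intro s
      refine (hv.norm_sub_le _ _).trans ?_
      simp only [curve, add_sub_add_left_eq_sub, ← smul_sub, norm_smul, Real.norm_eq_abs,
        Real.abs_exp]
      have h2 : ‖φ s - ψ s‖ ≤ dist φ ψ := by
        rw [← dist_eq_norm]
        exact BoundedContinuousFunction.dist_coe_le_dist s
      have h3 : (K : ℝ) * (Real.exp (l * |s|) * ‖φ s - ψ s‖) ≤
          K * (Real.exp (l * |s|) * dist φ ψ) := by gcongr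
      linarith
    have h4 : dist (T φ t) (T ψ t) = ‖Real.exp (-(l * |t|)) •
        ∫ s in (0 : ℝ)..t, (v (curve φ s) - v (curve ψ s))‖ := by
      rw [dist_eq_norm, intervalIntegral.integral_sub ((hvc φ).intervalIntegrable _ _)
        ((hvc ψ).intervalIntegrable _ _), smul_sub]
      rfl
    rw [h4, hexp]
    refine (mul_le_mul_of_nonneg_left (norm_integral_le_exp hl0 h1 t) (Real.exp_pos _).le).trans ?_
    rw [hcancel, div_le_iff₀ hl0]
    have h5 : 0 ≤ dist φ ψ := dist_nonneg
    push_cast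
    nlinarith
  obtain ⟨φ, hφ⟩ : ∃ φ, T φ = φ := ⟨_, hT.fixedPoint_isFixedPt⟩
  have hfix : ∀ t, curve φ t = x₀ + ∫ s in (0 : ℝ)..t, v (curve φ s) := by
    intro t
    have h1 : φ t = Real.exp (-(l * |t|)) • ∫ s in (0 : ℝ)..t, v (curve φ s) := by
      conv_lhs => rw [← hφ]
      rfl
    change x₀ + Real.exp (l * |t|) • φ t = _
    rw [h1, smul_smul, ← Real.exp_add, add_neg_cancel, Real.exp_zero, one_smul]
  refine ⟨curve φ, by rw [hfix]; simp, fun t => ?_⟩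
  have h1 : HasDerivAt (fun t => x₀ + ∫ s in (0 : ℝ)..t, v (curve φ s)) (v (curve φ t)) t :=
    (intervalIntegral.integral_hasDerivAt_right ((hvc φ).intervalIntegrable _ _)
      ((hvc φ).stronglyMeasurableAtFilter _ _) (hvc φ).continuousAt).const_add x₀
  exact h1.congr_of_eventuallyEq (Eventually.of_forall hfix)

end

/-! ### The flow of `ζ` on the space of periodic sequences -/

section

variable {K : ℝ≥0} {α : ℝ} {F : ℂ → ℂ} {m b : ℕ} {f : ℤ → ℂ ≃ₜ ℂ} {g g' : ℤ → ℝ → ℝ → ℝ}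

theorem IsDecomposition.zeta_mem (hf : IsDecomposition K α F m f g g') {z : ℤ → ℂ}
    (hz : z ∈ E m b) : zeta g g' z ∈ E m b := by
  have hz' : ∀ i, z (i + (m * b : ℕ)) = z i := hz
  have hg : ∀ i, g (i + (m * b : ℕ)) = g i := by
    have h1 : Function.Periodic g (m : ℤ) := hf.periodic_left
    have h2 := h1.nat_mul b
    intro i
    rw [← h2 i]
    congr 1
    push_cast
    ring
  have hg' : ∀ i, g' (i + (m * b : ℕ)) = g' i := by
    have h1 : Function.Periodic g' (m : ℤ) := hf.periodic_right
    have h2 := h1.nat_mul b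
    intro i
    rw [← h2 i]
    congr 1
    push_cast
    ring
  intro i
  simp only [zeta]
  rw [show i + ((m * b : ℕ) : ℤ) - 1 = i - 1 + (m * b : ℕ) by ring,
    show i + ((m * b : ℕ) : ℤ) + 1 = i + 1 + (m * b : ℕ) by ring, hz', hz', hz', hg, hg']

theorem apply_emod_of_mem_E {z : ℤ → ℂ} (hz : z ∈ E m b) (i : ℤ) : z (i % (m * b : ℕ)) = z i := by
  have h1 : Function.Periodic z ((m * b : ℕ) : ℤ) := hz
  have h2 := h1.int_mul (i / (m * b : ℕ)) (i % (m * b : ℕ))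
  rw [← h2]
  congr 1
  exact Int.emod_add_ediv_mul i _

/-- The periodic sequence with given values on one period. -/
def periodicExtension {N : ℕ} (hN : 0 < N) (u : Fin N → ℂ) (i : ℤ) : ℂ :=
  u ⟨(i % N).toNat, by
    have h1 := Int.emod_lt_of_pos i (by exact_mod_cast hN : (0 : ℤ) < N)
    omega⟩

theorem periodicExtension_mem (hN : 0 < m * b) (u : Fin (m * b) → ℂ) :
    periodicExtension hN u ∈ E m b := by
  intro i
  simp only [periodicExtension, Int.add_emod_right]

theorem IsLipschitzUntwisted.abs_left_sub_le {f : ℂ ≃ₜ ℂ} {g g' : ℝ → ℝ → ℝ}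
    (h : IsLipschitzUntwisted K f g g') (X y X' y' : ℝ) :
    |g X y - g X' y'| ≤ K * |X - X'| + K * |y - y'| := by
  have h1 := (h.left_lipschitz y).dist_le_mul X X'
  have h2 := (h.left_lipschitz_snd X').dist_le_mul y y'
  rw [Real.dist_eq, Real.dist_eq] at h1 h2
  exact (abs_sub_le _ (g X' y) _).trans (add_le_add h1 h2)

theorem IsLipschitzUntwisted.abs_right_sub_le {f : ℂ ≃ₜ ℂ} {g g' : ℝ → ℝ → ℝ}
    (h : IsLipschitzUntwisted K f g g') (X y X' y' : ℝ) :
    |g' X y - g' X' y'| ≤ K * |X - X'| + K * |y - y'| := by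
  have h1 := (h.right_lipschitz_fst y).dist_le_mul X X'
  have h2 := (h.right_lipschitz X').dist_le_mul y y'
  rw [Real.dist_eq, Real.dist_eq] at h1 h2
  exact (abs_sub_le _ (g' X' y) _).trans (add_le_add h1 h2)

theorem IsDecomposition.norm_zeta_sub_le (hf : IsDecomposition K α F m f g g') {z w : ℤ → ℂ} {D : ℝ}
    (h : ∀ i, ‖z i - w i‖ ≤ D) (i : ℤ) : ‖zeta g g' z i - zeta g g' w i‖ ≤ (2 + 4 * K) * D := by
  have hK : (0 : ℝ) ≤ K := K.2
  have hre : ∀ i, |(z i).re - (w i).re| ≤ D := fun i => by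
    rw [← Complex.sub_re]
    exact (Complex.abs_re_le_norm _).trans (h i)
  have him : ∀ i, |(z i).im - (w i).im| ≤ D := fun i => by
    rw [← Complex.sub_im]
    exact (Complex.abs_im_le_norm _).trans (h i)
  have h1 := (hf.untwisted (i - 1)).abs_right_sub_le (z i).re (z (i - 1)).im (w i).re
    (w (i - 1)).im
  have h2 := (hf.untwisted i).abs_left_sub_le (z (i + 1)).re (z i).im (w (i + 1)).re (w i).im
  have e1 := mul_le_mul_of_nonneg_left (hre i) hK
  have e2 := mul_le_mul_of_nonneg_left (him (i - 1)) hK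
  have e3 := mul_le_mul_of_nonneg_left (hre (i + 1)) hK
  have e4 := mul_le_mul_of_nonneg_left (him i) hK
  have a1 : |(zeta g g' z i - zeta g g' w i).re| ≤ D + 2 * K * D := by
    have : (zeta g g' z i - zeta g g' w i).re = ((z i).im - (w i).im) -
        (g' (i - 1) (z i).re (z (i - 1)).im - g' (i - 1) (w i).re (w (i - 1)).im) := by
      simp only [zeta, Complex.sub_re]
      ring
    rw [this]
    refine (abs_sub _ _).trans ?_
    linarith [him i]
  have a2 : |(zeta g g' z i - zeta g g' w i).im| ≤ D + 2 * K * D := by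
    have : (zeta g g' z i - zeta g g' w i).im = ((z i).re - (w i).re) -
        (g i (z (i + 1)).re (z i).im - g i (w (i + 1)).re (w i).im) := by
      simp only [zeta, Complex.sub_im]
      ring
    rw [this]
    refine (abs_sub _ _).trans ?_
    linarith [hre i]
  refine (Complex.norm_le_abs_re_add_abs_im _).trans ?_
  linarith

theorem IsDecomposition.exists_isOrbit (hf : IsDecomposition K α F m f g g') (hb : 0 < b)
    {z : ℤ → ℂ} (hz : z ∈ E m b) : ∃ γ, IsOrbit m b g g' γ ∧ γ 0 = z := by
  have hN : 0 < m * b := Nat.mul_pos hf.pos hb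
  let v : (Fin (m * b) → ℂ) → Fin (m * b) → ℂ := fun u j =>
    zeta g g' (periodicExtension hN u) (j : ℕ)
  have hv : LipschitzWith (2 + 4 * K) v := by
    refine LipschitzWith.of_dist_le_mul fun u u' => ?_
    rw [dist_pi_le_iff (by positivity)]
    intro j
    rw [dist_eq_norm]
    have := hf.norm_zeta_sub_le (z := periodicExtension hN u) (w := periodicExtension hN u')
      (D := dist u u') (fun i => by
        rw [← dist_eq_norm]
        exact dist_le_pi_dist u u' _) (j : ℕ)
    exact_mod_cast this
  obtain ⟨γ, h0, hγ⟩ := exists_orbit_of_lipschitz hv fun j => z (j : ℕ)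
  refine ⟨fun t => periodicExtension hN (γ t), ⟨fun t => periodicExtension_mem hN _, ?_⟩, ?_⟩
  · intro t i
    have h1 := hasDerivAt_pi.1 (hγ t) ⟨(i % (m * b : ℕ)).toNat, by
      have h1 := Int.emod_lt_of_pos i (by exact_mod_cast hN : (0 : ℤ) < (m * b : ℕ))
      omega⟩
    have h2 := apply_emod_of_mem_E (hf.zeta_mem (periodicExtension_mem hN (γ t))) i
    refine h1.congr_deriv ?_
    rw [← h2]
    have h3 : (((i % (m * b : ℕ)).toNat : ℕ) : ℤ) = i % (m * b : ℕ) :=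
      Int.toNat_of_nonneg (Int.emod_nonneg i (by exact_mod_cast hN.ne'))
    simp only [v, h3]
  · funext i
    simp only [periodicExtension, h0]
    rw [Int.toNat_of_nonneg (Int.emod_nonneg i (by exact_mod_cast hN.ne'))]
    exact apply_emod_of_mem_E hz i

/-! ### The increments of an orbit form a positively coupled system -/

/-- The interleaved coordinates `…, x_i, y_i, x_{i+1}, y_{i+1}, …`, with indices `2i`, `2i + 1`,
`2i + 2`, …, and with the sign of `x_i` and `y_i` changed for odd `i`. -/
noncomputable def coord (w : ℤ → ℂ) (k : ℤ) : ℝ :=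
  (-1) ^ (k / 2) * if Even k then (w (k / 2)).re else (w (k / 2)).im

theorem coord_even (w : ℤ → ℂ) (i : ℤ) : coord w (2 * i) = (-1) ^ i * (w i).re := by
  rw [coord, if_pos (even_two_mul i), Int.mul_ediv_cancel_left i two_ne_zero]

theorem coord_odd (w : ℤ → ℂ) (i : ℤ) : coord w (2 * i + 1) = (-1) ^ i * (w i).im := by
  rw [coord, if_neg (by simp [parity_simps]), show (2 * i + 1) / 2 = i by omega]

theorem coord_sub (w w' : ℤ → ℂ) (k : ℤ) : coord (w - w') k = coord w k - coord w' k := by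
  rcases Int.even_or_odd' k with ⟨i, rfl | rfl⟩
  · simp only [coord_even, Pi.sub_apply, Complex.sub_re]
    ring
  · simp only [coord_odd, Pi.sub_apply, Complex.sub_im]
    ring

theorem coord_zero (k : ℤ) : coord 0 k = 0 := by
  simp [coord]

theorem eq_zero_of_coord {w : ℤ → ℂ} (h : ∀ k, coord w k = 0) : w = 0 := by
  have h1 : ∀ i : ℤ, ((-1 : ℝ)) ^ i ≠ 0 := fun i => zpow_ne_zero _ (by norm_num)
  funext i
  apply Complex.ext
  · have := h (2 * i)
    rw [coord_even] at this
    simpa [h1 i] using this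
  · have := h (2 * i + 1)
    rw [coord_odd] at this
    simpa [h1 i] using this

theorem coord_add_period {w : ℤ → ℂ} (hw : w ∈ E m b) (k : ℤ) :
    coord w (k + (2 * (m * b) : ℕ)) = (-1) ^ (m * b) * coord w k := by
  have hw' : ∀ i, w (i + (m * b : ℕ)) = w i := hw
  have hpow : ∀ i : ℤ, ((-1 : ℝ)) ^ (i + (m * b : ℕ)) = (-1) ^ (m * b) * (-1) ^ i := by
    intro i
    rw [zpow_add₀ (by norm_num), zpow_natCast, mul_comm]
  rcases Int.even_or_odd' k with ⟨i, rfl | rfl⟩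
  · rw [show 2 * i + ((2 * (m * b) : ℕ) : ℤ) = 2 * (i + (m * b : ℕ)) by push_cast; ring,
      coord_even, coord_even, hw', hpow, mul_assoc]
  · rw [show 2 * i + 1 + ((2 * (m * b) : ℕ) : ℤ) = 2 * (i + (m * b : ℕ)) + 1 by push_cast; ring,
      coord_odd, coord_odd, hw', hpow, mul_assoc]

theorem sum_range_two_mul (h : ℕ → ℝ) (N : ℕ) :
    ∑ k ∈ Finset.range (2 * N), h k = ∑ j ∈ Finset.range N, (h (2 * j) + h (2 * j + 1)) := by
  induction N with
  | zero => simp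
  | succ N ih =>
    rw [show 2 * (N + 1) = 2 * N + 1 + 1 by ring, Finset.sum_range_succ, Finset.sum_range_succ, ih,
      Finset.sum_range_succ, add_assoc]

/-- In the interleaved coordinates `4 L` is the sum of the products of the signs of neighbours. -/
theorem four_mul_L {w : ℤ → ℂ} (hw : w ∈ E m b) :
    4 * L m b w = ∑ k ∈ Finset.range (2 * (m * b)),
      (SignType.sign (coord w k) : ℝ) * (SignType.sign (coord w (k + 1)) : ℝ) := by
  have hper : ∀ k : ℤ, (SignType.sign (coord w (k + (2 * (m * b) : ℕ))) : ℝ) *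
      (SignType.sign (coord w (k + (2 * (m * b) : ℕ) + 1)) : ℝ) =
      (SignType.sign (coord w k) : ℝ) * (SignType.sign (coord w (k + 1)) : ℝ) := by
    intro k
    rw [show k + ((2 * (m * b) : ℕ) : ℤ) + 1 = k + 1 + (2 * (m * b) : ℕ) by ring,
      coord_add_period hw, coord_add_period hw, ← SignType.coe_mul, ← SignType.coe_mul, ← sign_mul,
      ← sign_mul]
    congr 2
    have h1 : ((-1 : ℝ)) ^ (m * b) * (-1) ^ (m * b) = 1 := by
      rw [← mul_pow]
      norm_num
    linear_combination coord w k * coord w (k + 1) * h1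
  have hsq : ∀ i : ℤ, ((-1 : ℝ)) ^ i * (-1) ^ i = 1 := by
    intro i
    rcases Int.even_or_odd i with hk | hk <;> simp [hk.neg_one_zpow]
  rw [← sum_range_eq_of_periodic (M := 2 * (m * b)) (h := fun k => (SignType.sign (coord w k) : ℝ) *
    (SignType.sign (coord w (k + 1)) : ℝ)) hper 1, sum_range_two_mul, L, ← mul_assoc]
  rw [show (4 : ℝ) * (1 / 4) = 1 by norm_num, one_mul]
  refine Finset.sum_congr rfl fun j _ => ?_
  push_cast
  rw [show (1 : ℤ) + 2 * j = 2 * j + 1 by ring, show (2 : ℤ) * j + 1 + 1 = 2 * (j + 1) by ring,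
    show (1 : ℤ) + (2 * j + 1) = 2 * (j + 1) by ring, coord_odd, coord_even, coord_odd]
  simp only [← SignType.coe_mul, ← sign_mul, mul_sub]
  have e1 : (-1 : ℝ) ^ (j : ℤ) * (w j).im * ((-1) ^ ((j : ℤ) + 1) * (w (j + 1)).re) =
      -((w (j + 1)).re * (w j).im) := by
    rw [zpow_add_one₀ (by norm_num)]
    linear_combination -(w (j + 1)).re * (w j).im * hsq j
  have e2 : (-1 : ℝ) ^ ((j : ℤ) + 1) * (w (j + 1)).re * ((-1) ^ ((j : ℤ) + 1) * (w (j + 1)).im) =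
      (w (j + 1)).re * (w (j + 1)).im := by
    linear_combination (w (j + 1)).re * (w (j + 1)).im * hsq (j + 1)
  rw [e1, e2, Left.sign_neg, SignType.coe_neg]
  ring

theorem exists_coeff_of_lipschitz {h : ℝ → ℝ} (hl : LipschitzWith K h) (y y' : ℝ) :
    ∃ A : ℝ, |A| ≤ K ∧ h y' - h y = A * (y' - y) := by
  by_cases hy : y' - y = 0
  · exact ⟨0, by simp, by rw [sub_eq_zero.1 hy]; ring⟩
  · refine ⟨(h y' - h y) / (y' - y), ?_, by field_simp⟩
    have h1 := hl.dist_le_mul y' y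
    rw [Real.dist_eq, Real.dist_eq] at h1
    rw [abs_div, div_le_iff₀ (abs_pos.2 hy)]
    exact h1

theorem exists_coeff_of_strictMono {h : ℝ → ℝ} (hK : 1 < K) (hm : StrictMono h)
    (hl : LipschitzWith K h) (ha : AntilipschitzWith K h) (y y' : ℝ) :
    ∃ B : ℝ, ((K : ℝ)⁻¹ ≤ B ∧ B ≤ K) ∧ h y' - h y = B * (y' - y) := by
  have hK1 : (1 : ℝ) < K := by exact_mod_cast hK
  by_cases hy : y' - y = 0
  · exact ⟨1, ⟨inv_le_one_of_one_le₀ hK1.le, hK1.le⟩, by rw [sub_eq_zero.1 hy]; ring⟩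
  · have h1 := hl.dist_le_mul y' y
    have h2 := ha.le_mul_dist y' y
    rw [Real.dist_eq, Real.dist_eq] at h1 h2
    have hpos : 0 < (h y' - h y) / (y' - y) := by
      rcases lt_or_gt_of_ne (sub_ne_zero.1 hy) with h3 | h3
      · exact div_pos_of_neg_of_neg (sub_neg.2 (hm h3)) (sub_neg.2 h3)
      · exact div_pos (sub_pos.2 (hm h3)) (sub_pos.2 h3)
    refine ⟨(h y' - h y) / (y' - y), ?_, by field_simp⟩
    rw [← abs_of_pos hpos, abs_div]
    have hy' := abs_pos.2 hy
    constructor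
    · rw [le_div_iff₀ hy', inv_mul_le_iff₀ (by linarith)]
      exact h2
    · rw [div_le_iff₀ hy']
      exact h1

theorem IsOrbit.isPositivelyCoupled (hf : IsDecomposition K α F m f g g') (hK : 1 < K)
    {γ : ℝ → ℤ → ℂ} (hγ : IsOrbit m b g g' γ) :
    IsPositivelyCoupled K (fun k t => coord (γ t - γ 0) k)
      (fun k t => coord (zeta g g' (γ t)) k) where
  map_zero k := by rw [sub_self, coord_zero]
  hasDerivAt k t := by
    simp only [coord_sub]
    refine HasDerivAt.sub_const _ ?_
    rcases Int.even_or_odd' k with ⟨i, rfl | rfl⟩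
    · simp only [coord_even]
      exact (Complex.reCLM.hasFDerivAt.comp_hasDerivAt t (hγ.2 t i)).const_mul _
    · simp only [coord_odd]
      exact (Complex.imCLM.hasFDerivAt.comp_hasDerivAt t (hγ.2 t i)).const_mul _
  coupling k t := by
    rcases Int.even_or_odd' k with ⟨i, rfl | rfl⟩
    · have hu := hf.untwisted (i - 1)
      obtain ⟨B, hB, hB'⟩ := exists_coeff_of_strictMono hK (hu.strictMono_right (γ t i).re)
        (hu.right_lipschitz _) (hu.right_antilipschitz _) (γ 0 (i - 1)).im (γ t (i - 1)).im
      obtain ⟨A, hA, hA'⟩ := exists_coeff_of_lipschitz (hu.right_lipschitz_fst (γ 0 (i - 1)).im)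
        (γ 0 i).re (γ t i).re
      have hK1 : (1 : ℝ) < K := by exact_mod_cast hK
      refine ⟨B, 1, -A, hB, ⟨inv_le_one_of_one_le₀ hK1.le, hK1.le⟩, by rwa [abs_neg], ?_⟩
      rw [show 2 * i - 1 = 2 * (i - 1) + 1 by ring, coord_even, coord_even, coord_odd, coord_odd,
        coord_even, zpow_sub_one₀ (by norm_num)]
      simp only [zeta, Pi.sub_apply, Complex.sub_re, Complex.sub_im]
      linear_combination (-(-1 : ℝ) ^ i) * hB' + (-(-1 : ℝ) ^ i) * hA'
    · have hu := hf.untwisted i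
      obtain ⟨B, hB, hB'⟩ := exists_coeff_of_strictMono hK (hu.strictMono_left (γ t i).im)
        (hu.left_lipschitz _) (hu.left_antilipschitz _) (γ 0 (i + 1)).re (γ t (i + 1)).re
      obtain ⟨A, hA, hA'⟩ := exists_coeff_of_lipschitz (hu.left_lipschitz_snd (γ 0 (i + 1)).re)
        (γ 0 i).im (γ t i).im
      have hK1 : (1 : ℝ) < K := by exact_mod_cast hK
      refine ⟨1, B, -A, ⟨inv_le_one_of_one_le₀ hK1.le, hK1.le⟩, hB, by rwa [abs_neg], ?_⟩
      rw [show 2 * i + 1 - 1 = 2 * i by ring, show 2 * i + 1 + 1 = 2 * (i + 1) by ring, coord_odd,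
        coord_odd, coord_even, coord_even, coord_odd, zpow_add_one₀ (by norm_num)]
      simp only [zeta, Pi.sub_apply, Complex.sub_re, Complex.sub_im]
      linear_combination (-(-1 : ℝ) ^ i) * hB' + (-(-1 : ℝ) ^ i) * hA'

theorem mem_V'_of_coord {w : ℤ → ℂ} (hw : w ∈ E m b)
    (h : ∀ k, coord w k = 0 → coord w (k - 1) * coord w (k + 1) < 0) : w ∈ V' m b := by
  have hsq : ∀ i : ℤ, ((-1 : ℝ)) ^ i * (-1) ^ i = 1 := by
    intro i
    rcases Int.even_or_odd i with hk | hk <;> simp [hk.neg_one_zpow]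
  refine ⟨hw, fun i => ⟨fun h0 => ?_, fun h0 => ?_⟩⟩
  · have h1 := h (2 * i) (by rw [coord_even, h0, mul_zero])
    rw [show 2 * i - 1 = 2 * (i - 1) + 1 by ring, coord_odd, coord_odd,
      zpow_sub_one₀ (by norm_num)] at h1
    linear_combination h1 + (w (i - 1)).im * (w i).im * hsq i
  · have h1 := h (2 * i + 1) (by rw [coord_odd, h0, mul_zero])
    rw [show 2 * i + 1 - 1 = 2 * i by ring, show 2 * i + 1 + 1 = 2 * (i + 1) by ring, coord_even,
      coord_even, zpow_add_one₀ (by norm_num)] at h1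
    linear_combination h1 + (w i).re * (w (i + 1)).re * hsq i

end

/-! ### The vector field on the invariant disk -/

section

variable {K : ℝ≥0} {α : ℝ} {F : ℂ → ℂ} {m b : ℕ} {f : ℤ → ℂ ≃ₜ ℂ} {g g' : ℤ → ℝ → ℝ → ℝ} {a : ℤ}
  {Δ S : Set (ℤ → ℂ)} {z : ℤ → ℂ}

/-- The vector field does not vanish on `Δ^*`: a constant orbit does not tend to `0`. -/
theorem IsInvariantDisk.zeta_ne_zero (hΔ : IsInvariantDisk m b g g' S Δ)
    (hz : z ∈ punctured Δ S) : zeta g g' z ≠ 0 := by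
  intro h0
  have horb : IsOrbit m b g g' fun _ => z := by
    refine ⟨fun _ => hΔ.subset hz.1, fun t i => ?_⟩
    rw [h0]
    exact hasDerivAt_const t (z i)
  have h1 := tendsto_nhds_unique tendsto_const_nhds (hΔ.limits _ horb hz).1
  exact hz.2 (Or.inl h1)

theorem L_smul {c : ℝ} (hc : 0 < c) (w : ℤ → ℂ) : L m b (c • w) = L m b w := by
  simp only [L, Pi.smul_apply, Complex.smul_re, Complex.smul_im, smul_eq_mul, sign_mul,
    sign_pos hc, one_mul]

/-- If the linking number of any two points of the invariant disk is `a`, then the value of the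
vector field at a point of `Δ^*` belongs to `V'`, because the linking number of `z^t` and `z` does
not change as `t` goes through `0`; and its linking number is that of `z^t` and `z` for small
`t`. -/
theorem IsInvariantDisk.zeta_mem_and_L_eq (hf : IsDecomposition K α F m f g g') (hK : 1 < K)
    (hb : 0 < b) (hΔ : IsInvariantDisk m b g g' S Δ) {c : ℝ}
    (hL : ∀ z ∈ Δ, ∀ w ∈ Δ, z ≠ w → L m b (z - w) = c) (hz : z ∈ punctured Δ S) :
    zeta g g' z ∈ V' m b ∧ L m b (zeta g g' z) = c := by
  have hE := hΔ.subset hz.1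
  obtain ⟨γ, hγ, hγ0⟩ := hf.exists_isOrbit hb hE
  have hmem : ∀ t, γ t ∈ Δ := hΔ.flow_invariant γ hγ (by rw [hγ0]; exact hz.1)
  have hsys := hγ.isPositivelyCoupled hf hK
  have hK0 : (0 : ℝ) < K := by exact_mod_cast zero_lt_one.trans hK
  have hζE := hf.zeta_mem hE
  have hsub : ∀ t, γ t - γ 0 ∈ E m b := fun t => (E m b).sub_mem (hγ.1 t) (hγ.1 0)
  obtain ⟨k₀, hk₀⟩ : ∃ k, coord (zeta g g' (γ 0)) k ≠ 0 := by
    by_contra hcon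
    push Not at hcon
    rw [hγ0] at hcon
    exact hΔ.zeta_ne_zero hz (eq_zero_of_coord hcon)
  have hne : ∀ {t}, SignType.sign (coord (γ t - γ 0) k₀) ≠ 0 → γ t ≠ γ 0 := by
    intro t h1 h2
    rw [h2, sub_self, coord_zero, sign_zero] at h1
    exact h1 rfl
  have hpos : ∀ᶠ t in 𝓝[>] (0 : ℝ), L m b (γ t - γ 0) = c := by
    filter_upwards [hsys.sign_right hK0 k₀ 0 hk₀ (fun l h1 h2 => by simp at h2; omega)
      (by simpa using mul_self_nonneg _)] with t ht
    refine hL _ (hmem t) _ (hmem 0) (hne ?_)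
    rw [Nat.cast_zero, add_zero] at ht
    rw [ht]
    exact sign_ne_zero.2 hk₀
  have hneg : ∀ᶠ t in 𝓝[>] (0 : ℝ), L m b (γ (-t) - γ 0) = c := by
    filter_upwards [hsys.sign_neg_time hK0 k₀ hk₀] with t ht
    refine hL _ (hmem _) _ (hmem 0) (hne ?_)
    rw [ht, ← Left.sign_neg]
    exact sign_ne_zero.2 (neg_ne_zero.2 hk₀)
  have hV : zeta g g' z ∈ V' m b := by
    refine mem_V'_of_coord hζE ?_
    rw [← hγ0]
    refine hsys.mul_neg hK0 (M := 2 * (m * b)) (Nat.mul_pos two_pos (Nat.mul_pos hf.pos hb))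
      (ε := (-1) ^ (m * b)) ?_ (fun k t => coord_add_period (hsub t) k)
      (fun k => coord_add_period (hf.zeta_mem (hγ.1 0)) k) ⟨k₀, hk₀⟩ ?_
    · rw [← mul_pow]
      norm_num
    · filter_upwards [hpos, hneg] with t h1 h2
      rw [← four_mul_L (hsub t), ← four_mul_L (hsub (-t)), h1, h2]
  refine ⟨hV, ?_⟩
  -- the difference quotients of the orbit tend to `ζ z`
  have hlim : Tendsto (fun t : ℝ => t⁻¹ • (γ t - γ 0)) (𝓝[>] 0) (𝓝[E m b] (zeta g g' z)) := by
    refine tendsto_nhdsWithin_iff.2 ⟨tendsto_pi_nhds.2 fun i => ?_,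
      Eventually.of_forall fun t => (E m b).smul_mem _ (hsub t)⟩
    have h1 := (hasDerivAt_iff_tendsto_slope_zero.1 (hγ.2 0 i)).mono_left
      (nhdsWithin_mono (0 : ℝ) (fun t (ht : t ∈ Set.Ioi 0) => ht.ne'))
    rw [hγ0] at h1 ⊢
    simpa using h1
  obtain ⟨t, h1, h2, ht⟩ := ((hlim.eventually (L_eventually_eq m b _ hV)).and
    (hpos.and self_mem_nhdsWithin)).exists
  rw [← h1, L_smul (inv_pos.2 ht), h2]

end

end PseudoRotation

theorem mainTheorem7 (f₀ : ℂ → ℂ) (α β : ℝ)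
    (hf₀ : PseudoRotation.IsIrrationalPseudoRotation f₀)
    (hα : ∀ z : ℂ, ‖z‖ = 1 → f₀ z = PseudoRotation.rot α z)
    (hαβ : α < β) (hβ : Irrational β) (hint : ∀ n : ℤ, ¬ (α < n ∧ (n : ℝ) < β))
    (K : ℝ≥0) (hK : 1 < K) (m : ℕ) (f : ℤ → ℂ ≃ₜ ℂ) (g g' : ℤ → ℝ → ℝ → ℝ)
    (hf : PseudoRotation.IsDecomposition K α (PseudoRotation.extendMap f₀ α β) m f g g')
    (b : ℕ) (hb : 2 ≤ b) (a : ℤ) (ha : b * α < a ∧ (a : ℝ) < b * β)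
    (Δ : Set (ℤ → ℂ))
    (hΔ : PseudoRotation.IsInvariantDisk m b g g'
      (PseudoRotation.singularCurve α m b g g' a) Δ)
    (z : ℤ → ℂ)
    (hz : z ∈ PseudoRotation.punctured Δ (PseudoRotation.singularCurve α m b g g' a)) :
    PseudoRotation.zeta g g' z ∈ PseudoRotation.V' m b ∧
      PseudoRotation.L m b (PseudoRotation.zeta g g' z) = a := by
  have hb0 : 0 < b := by omega
  have hb' : (0 : ℝ) < b := by exact_mod_cast hb0
  have hr : (1 : ℝ) ≤ 1 + a / b - α := by
    have : α < a / b := by rw [lt_div_iff₀ hb']; linarith [ha.1]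
    linarith
  obtain ⟨φ, -, -, hφ, hφs⟩ := hΔ.isDisk
  have hσ : φ 1 ∈ PseudoRotation.singularCurve α m b g g' a := hφs ▸ ⟨1, by simp, rfl⟩
  have hσΔ : φ 1 ∈ Δ := hφ ▸ ⟨1, by simp [PseudoRotation.disk], rfl⟩
  have hσ0 : φ 1 ≠ 0 := by
    intro h
    have := hσ.2.2 0
    rw [h, Pi.zero_apply, norm_zero] at this
    linarith
  refine hΔ.zeta_mem_and_L_eq hf hK hb0 (fun z hz w hw hzw => ?_) hz
  rw [hΔ.L_sub_eq_L hf hr hz hw hσΔ hσ0 hzw, hf.L_singularCurve hα hb0 ha hσ]
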